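/- Let $k\ge 1$, $\beta\in\mathbb R$ and $0=q_0\le q_1\le\dots\le q_k=1$. For $\boldsymbol m=(m_0,\dots,m_{k+1})$ with $0=m_0\le m_1\le\dots\le m_k\le m_{k+1}=1$ define $$\Psi_{k\mathrm{RSB}}(\boldsymbol q,\boldsymbol m)=-\frac{\beta^2}{4}+\frac{\beta^2}{4}\sum_{i=0}^{k}(m_{i+1}-m_i)q_i^2+\psi_0 ,$$ where $\psi_k(x_1,\dots,x_k)=\log 2\cosh\big(\beta\sum_{l=1}^k\sqrt{q_l-q_{l-1}}\,x_l\big)$ and, for $l=k-1,\dots,0$ and $G\sim\mathsf N(0,1)$, $$\psi_l(x_1,\dots,x_l)=\frac1{m_{l+1}}\log\mathbb E\big[\exp\big(m_{l+1}\,\psi_{l+1}(x_1,\dots,x_l,G)\big)\big]$$ (read as $\mathbb E[\psi_{l+1}(x_1,\dots,x_l,G)]$ if $m_{l+1}=0$). If $0<m_1<\dots<m_k<1$, the Ruelle probability cascade (RPC) with parameters $\boldsymbol m$ is defined as follows. Let $V=\mathbb N^0\cup\mathbb N^1\cup\dots\cup\mathbb N^k$ be the vertices of the infinite tree of depth $k$.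 For each vertex $\gamma$ of level $|\gamma|=l<k$ let $\{x_{\gamma n}:n\in\mathbb N\}$ be (an enumeration of) a Poisson point process on $\mathbb R$ with intensity $m_{l+1}e^{-m_{l+1}x}\,dx$, the processes attached to different $\gamma$ being independent. For $\alpha\in\mathbb N^k$ let $\mathcal P(\alpha)$ be the set of the $k$ non-root vertices on the path from the root to $\alpha$, $z_\alpha=\sum_{\gamma\in\mathcal P(\alpha)}x_\gamma$, and $\nu_\alpha=e^{z_\alpha}/\sum_{\delta\in\mathbb N^k}e^{z_\delta}$. Let $\{g_\gamma:\gamma\in\mathbb N^1\cup\dots\cup\mathbb N^k\}$ be i.i.d. standard Gaussian random variables independent of $\{\nu_\alpha\}_{\alpha\in\mathbb N^k}$, and set, for $\alpha\in\mathbb N^k$, $$h_\alpha=\beta\sum_{\gamma\in\mathcal P(\alpha)}\sqrt{q_{|\gamma|}-q_{|\gamma|-1}}\;g_\gamma,\qquad s_\alpha=\beta\sum_{\gamma\in\mathcal P(\alpha)}\sqrt{\tfrac12q_{|\gamma|}^2-\tfrac12q_{|\gamma|-1}^2}\;g_\gamma .$$ (1) If $0=m_0<m_1<\dots<m_k<m_{k+1}=1$,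 then almost surely $\sum_\alpha e^{z_\alpha}$, $\sum_\alpha\nu_\alpha\cosh h_\alpha$ and $\sum_\alpha\nu_\alpha e^{s_\alpha}$ converge, the two logarithms below are integrable, and $$\Psi_{k\mathrm{RSB}}(\boldsymbol q,\boldsymbol m)=\mathbb E\Big[\log\Big(2\sum_{\alpha}\nu_\alpha\cosh(h_\alpha)\Big)\Big]-\mathbb E\Big[\log\Big(\sum_\alpha\nu_\alpha e^{s_\alpha}\Big)\Big].$$ (2) For all $0=m_0\le m_1\le\dots\le m_k\le m_{k+1}=1$ (in particular for $m_k=1$) the identity holds in the sense of limits: as nondegenerate parameters $\boldsymbol m'$ as in (1) tend to $\boldsymbol m$, the right-hand side of the identity, formed with an RPC with parameters $\boldsymbol m'$, tends to $\Psi_{k\mathrm{RSB}}(\boldsymbol q,\boldsymbol m)$. -/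

import Mathlib

open MeasureTheory ProbabilityTheory
open scoped ENNReal NNReal

noncomputable section

/-! ### Poisson point processes on the line -/

/-- The number (with multiplicity) of points of the sequence `X` that lie in `B`. -/
def pointCount (X : ℕ → ℝ) (B : Set ℝ) : ℝ≥0∞ := ∑' n, B.indicator 1 (X n)

/-- `X` is a measurable enumeration of a Poisson point process on `ℝ` with intensity measure `Λ`:
the number of points in a Borel set `B` is Poisson with mean `Λ B` (and a.s. infinite if
`Λ B = ∞`), and the numbers of points in disjoint Borel sets are independent. -/
structure IsPoissonProcess {Ω : Type*} [MeasurableSpace Ω] (P : Measure Ω) (Λ : Measure ℝ)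
    (X : ℕ → Ω → ℝ) : Prop where
  measurable : ∀ n, Measurable (X n)
  count_law : ∀ B : Set ℝ, MeasurableSet B → Λ B ≠ ∞ →
    P.map (fun ω => pointCount (fun n => X n ω) B)
      = (poissonMeasure (Λ B).toNNReal).map (fun j : ℕ => (j : ℝ≥0∞))
  count_infinite : ∀ B : Set ℝ, MeasurableSet B → Λ B = ∞ →
    ∀ᵐ ω ∂P, pointCount (fun n => X n ω) B = ∞
  indep : ∀ (r : ℕ) (B : Fin r → Set ℝ), (∀ i, MeasurableSet (B i)) →
    Pairwise (fun i j => Disjoint (B i) (B j)) →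
    iIndepFun (fun i ω => pointCount (fun n => X n ω) (B i)) P

/-- The measure `a e^{-a x} dx` on `ℝ`. -/
def expIntensity (a : ℝ) : Measure ℝ :=
  volume.withDensity (fun x => ENNReal.ofReal (a * Real.exp (-(a * x))))

/-! ### Ruelle probability cascades

Vertices of the infinite tree with `k` levels are lists of natural numbers of length at most `k`;
the root is `[]`, the children of `γ` are the lists `γ ++ [n]`, and the leaves are given by
`α : Fin k → ℕ`. -/

/-- The ancestor at level `l ≤ k` of the leaf `α`. -/
def ancestor {k : ℕ} (α : Fin k → ℕ) (l : ℕ) : List ℕ := (List.ofFn α).take l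

/-- The random points `x γ` (for `γ` of length `1, …, k`) of a cascade with parameters
`m 1, …, m k`: for each vertex `γ` of length `l < k` the points `x (γ ++ [n])`, `n ∈ ℕ`, attached
to its children enumerate a Poisson process with intensity `m (l + 1) e^{-m (l + 1) x} dx`, and
these processes are independent for different `γ`. -/
structure IsCascade {Ω : Type*} [MeasurableSpace Ω] (P : Measure Ω) (k : ℕ) (m : ℕ → ℝ)
    (x : List ℕ → Ω → ℝ) : Prop where
  poisson : ∀ γ : List ℕ, γ.length < k →
    IsPoissonProcess P (expIntensity (m (γ.length + 1))) (fun n => x (γ ++ [n]))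
  indep : iIndepFun
    (fun (γ : {γ : List ℕ // γ.length < k}) (ω : Ω) (n : ℕ) => x (γ.1 ++ [n]) ω) P

/-- `z_α`, the sum of the points along the path from the root to the leaf `α`. -/
def pathSum {k : ℕ} (x : List ℕ → ℝ) (α : Fin k → ℕ) : ℝ :=
  ∑ l ∈ Finset.Icc 1 k, x (ancestor α l)

/-- The weights `ν_α = e^{z_α} / ∑_δ e^{z_δ}`. -/
def rpcWeight {k : ℕ} (x : List ℕ → ℝ) (α : Fin k → ℕ) : ℝ :=
  Real.exp (pathSum x α) / ∑' δ : Fin k → ℕ, Real.exp (pathSum x δ)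

/-- `x` generates a Ruelle probability cascade with parameters `m 1, …, m k`, and the `g γ`, for
`γ` a vertex other than the root, are i.i.d. standard Gaussians independent of the weights of
that cascade. -/
structure IsRPCWithGaussians {Ω : Type*} [MeasurableSpace Ω] (P : Measure Ω) (k : ℕ) (m : ℕ → ℝ)
    (x g : List ℕ → Ω → ℝ) : Prop where
  cascade : IsCascade P k m x
  gaussian_measurable : ∀ γ : List ℕ, γ ≠ [] → γ.length ≤ k → Measurable (g γ)
  gaussian_law : ∀ γ : List ℕ, γ ≠ [] → γ.length ≤ k → P.map (g γ) = gaussianReal 0 1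
  gaussian_indep : iIndepFun
    (fun (γ : {γ : List ℕ // γ ≠ [] ∧ γ.length ≤ k}) (ω : Ω) => g γ.1 ω) P
  indep : IndepFun
    (fun (ω : Ω) (α : Fin k → ℕ) => rpcWeight (fun γ => x γ ω) α)
    (fun (ω : Ω) (γ : {γ : List ℕ // γ ≠ [] ∧ γ.length ≤ k}) => g γ.1 ω) P

/-- `h_α = β ∑_{l = 1}^k √(q_l - q_{l-1}) g_{α|l}`. -/
def hField {k : ℕ} (β : ℝ) (q : ℕ → ℝ) (g : List ℕ → ℝ) (α : Fin k → ℕ) : ℝ :=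
  β * ∑ l ∈ Finset.Icc 1 k, √(q l - q (l - 1)) * g (ancestor α l)

/-- `s_α = β ∑_{l = 1}^k √(q_l² / 2 - q_{l-1}² / 2) g_{α|l}`. -/
def sField {k : ℕ} (β : ℝ) (q : ℕ → ℝ) (g : List ℕ → ℝ) (α : Fin k → ℕ) : ℝ :=
  β * ∑ l ∈ Finset.Icc 1 k, √(q l ^ 2 / 2 - q (l - 1) ^ 2 / 2) * g (ancestor α l)

/-! ### The `k`-RSB free energy functional -/

/-- `(1/a) log E exp(a φ(G))` for a standard Gaussian `G`, read as its limit `E φ(G)` at `a = 0`. -/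
def parisiStep (a : ℝ) (φ : ℝ → ℝ) : ℝ :=
  if a = 0 then ∫ y, φ y ∂(gaussianReal 0 1)
  else 1 / a * Real.log (∫ y, Real.exp (a * φ y) ∂(gaussianReal 0 1))

/-- The number `ψ_0` obtained from `ψ_k : ℝ^k → ℝ` by the backward recursion
`ψ_l(x_1, …, x_l) = (1 / m_{l+1}) log E exp(m_{l+1} ψ_{l+1}(x_1, …, x_l, G))`. -/
def parisiRecursion (m : ℕ → ℝ) : (k : ℕ) → ((Fin k → ℝ) → ℝ) → ℝ
  | 0, ψ => ψ Fin.elim0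
  | k + 1, ψ => parisiRecursion m k fun x =>
      parisiStep (m (k + 1)) fun y => ψ (Fin.snoc (α := fun _ => ℝ) x y)

/-- The `k`-RSB free energy functional; the terminal function of the recursion is
`ψ_k(x_1, …, x_k) = log 2 cosh (β ∑_{l = 1}^k √(q_l - q_{l-1}) x_l)`
(here `i : Fin k` stands for `l = i + 1`). -/
def PsiRSB (β : ℝ) (k : ℕ) (q m : ℕ → ℝ) : ℝ :=
  -(β ^ 2 / 4) + β ^ 2 / 4 * ∑ i ∈ Finset.range (k + 1), (m (i + 1) - m i) * q i ^ 2
    + parisiRecursion m k fun x =>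
        Real.log (2 * Real.cosh (β * ∑ i : Fin k, √(q (i + 1) - q i) * x i))

end

noncomputable section

open Filter Topology Set

/-! For a function `F` of the Gaussians along a path let `Z_F = ∑_α exp (z_α + F_α)`. The Laplace
transform of `Z_F` can be computed exactly. Average over the Gaussians at the leaves, then over the
Poisson points at the leaves by the Laplace functional of a Poisson process. An exponential
intensity is only rescaled by a shift, so `∑_α exp (s + a (z_α + F_α))` at depth `k + 1` is replaced
by a sum of the same form at depth `k`: `a = m_{k+2}` becomes `b = m_{k+1}`, `F` becomes its
`parisiStep b`, and `s` becomes `D' + (b / a) s` (`lintegral_one_sub_leafExponent`). Iterating from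
`m_{k+1} = 1` gives `E exp (-e^s Z_F) = exp (-exp (D + m_1 ψ_0(F) + m_1 s))`, a stable law of index
`m_1` (`exists_lintegral_expNeg_treeSum`), with `D` independent of `F`.

Integrating this transform over `s` gives the moments of `Z_F` of small positive and negative order.
The moment generating functions of `log Z_F` and `log Z_0` therefore differ by the factor `e^{c
ψ_0(F)}`, and differentiating at `c = 0` yields `E log Z_F - E log Z_0 = ψ_0(F)`
(`integral_log_of_stable`). Since `∑_α ν_α e^{F_α} = Z_F / Z_0`, the expected logarithm of a cascade
average is `ψ_0(F)`.

Taking `F = log 2 cosh` of the field gives the first term of the identity. For the linear field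
`s_α` the recursion is explicit, and summation by parts gives the polynomial part of the functional.
The degenerate case follows from the continuity of the functional in `m`, which rests on growth
bounds uniform in the parameters. -/

/-! ### The function `e^{-z}` on `[0, ∞]` -/

/-- `e^{-z}` for `z ∈ [0, ∞]`. -/
def expNeg (z : ℝ≥0∞) : ℝ≥0∞ := EReal.exp (-(z : EReal))

/-- `-log p` for `p ∈ [0, 1]`. -/
def negLog (p : ℝ≥0∞) : ℝ≥0∞ := (-ENNReal.log p).toENNReal

@[simp] lemma expNeg_zero : expNeg 0 = 1 := by simp [expNeg]

@[simp] lemma expNeg_top : expNeg ∞ = 0 := by simp [expNeg]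

lemma expNeg_add (a b : ℝ≥0∞) : expNeg (a + b) = expNeg a * expNeg b := by
  rw [expNeg, EReal.coe_ennreal_add, EReal.neg_add (Or.inl (EReal.coe_ennreal_ne_bot a))
    (Or.inr (EReal.coe_ennreal_ne_bot b)), sub_eq_add_neg, EReal.exp_add]
  rfl

lemma expNeg_antitone : Antitone expNeg := fun _ _ h =>
  EReal.exp_monotone (EReal.neg_le_neg_iff.2 (EReal.coe_ennreal_le_coe_ennreal_iff.2 h))

lemma expNeg_le_one (z : ℝ≥0∞) : expNeg z ≤ 1 := by
  simpa using expNeg_antitone (zero_le (a := z))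

lemma expNeg_ne_top (z : ℝ≥0∞) : expNeg z ≠ ∞ := ((expNeg_le_one z).trans_lt ENNReal.one_lt_top).ne

lemma continuous_expNeg : Continuous expNeg :=
  ENNReal.continuous_exp.comp (continuous_neg.comp continuous_coe_ennreal_ereal)

@[fun_prop]
lemma measurable_expNeg : Measurable expNeg := continuous_expNeg.measurable

@[fun_prop]
lemma measurable_negLog : Measurable negLog :=
  (continuous_neg.measurable.comp ENNReal.measurable_log).ereal_toENNReal

lemma expNeg_ofReal {r : ℝ} (hr : 0 ≤ r) :
    expNeg (ENNReal.ofReal r) = ENNReal.ofReal (Real.exp (-r)) := by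
  rw [expNeg, EReal.coe_ennreal_ofReal, max_eq_left hr, ← EReal.coe_neg, EReal.exp_coe]

/-- Laplace transforms take values in `[0, 1]`, so each of them is `expNeg` of some exponent;
`leafExponent` is formed in this way. -/
lemma expNeg_negLog {p : ℝ≥0∞} (hp : p ≤ 1) : expNeg (negLog p) = p := by
  rw [expNeg, negLog, EReal.coe_toENNReal, neg_neg, ENNReal.exp_log]
  rw [EReal.neg_nonneg]
  exact ENNReal.log_le_zero_iff.2 hp

lemma expNeg_sum {ι : Type*} (s : Finset ι) (f : ι → ℝ≥0∞) :
    expNeg (∑ i ∈ s, f i) = ∏ i ∈ s, expNeg (f i) := by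
  classical
  induction s using Finset.induction_on with
  | empty => simp
  | insert a s ha ih => rw [Finset.sum_insert ha, Finset.prod_insert ha, expNeg_add, ih]

/-! ### Laplace transforms of countable sums and decoupling -/

section Independence

variable {Ω : Type*} [MeasurableSpace Ω] {P : Measure Ω}

/-- The Laplace transform of a countable sum of independent variables is the product of their
Laplace transforms. -/
lemma lintegral_expNeg_tsum [IsProbabilityMeasure P] {ι : Type*} [Countable ι] {Y : ι → Ω → ℝ≥0∞} {c : ι → ℝ≥0∞}
    (hY : ∀ i, Measurable (Y i)) (hind : iIndepFun Y P)
    (hc : ∀ i, ∫⁻ ω, expNeg (Y i ω) ∂P = expNeg (c i)) :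
    ∫⁻ ω, expNeg (∑' i, Y i ω) ∂P = expNeg (∑' i, c i) := by
  have hfin : ∀ s : Finset ι, ∫⁻ ω, expNeg (∑ i ∈ s, Y i ω) ∂P = expNeg (∑ i ∈ s, c i) := by
    intro s
    simp_rw [expNeg_sum, ← hc]
    have h := lintegral_prod_eq_prod_lintegral_of_indepFun (μ := P) s
      (fun i ω => expNeg (Y i ω)) (hind.comp (fun _ => expNeg) fun _ => measurable_expNeg)
      (fun i => measurable_expNeg.comp (hY i))
    simpa using h
  have h1 : Tendsto (fun s : Finset ι => ∫⁻ ω, expNeg (∑ i ∈ s, Y i ω) ∂P) atTop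
      (𝓝 (∫⁻ ω, expNeg (∑' i, Y i ω) ∂P)) := by
    -- As `ι` is countable, `atTop` on `Finset ι` is countably generated, so dominated convergence
    -- is available along it, with bound `1`.
    refine tendsto_lintegral_filter_of_dominated_convergence (fun _ => 1)
      (Eventually.of_forall fun s => ?_) (Eventually.of_forall fun s => ?_) (by simp) ?_
    · exact measurable_expNeg.comp (Finset.measurable_fun_sum s fun i _ => hY i)
    · exact Eventually.of_forall fun ω => expNeg_le_one _
    · refine Eventually.of_forall fun ω => ?_
      exact (continuous_expNeg.tendsto _).comp (ENNReal.summable (f := fun i => Y i ω)).hasSum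
  have h2 : Tendsto (fun s : Finset ι => expNeg (∑ i ∈ s, c i)) atTop
      (𝓝 (expNeg (∑' i, c i))) :=
    (continuous_expNeg.tendsto _).comp (ENNReal.summable (f := c)).hasSum
  simp_rw [hfin] at h1
  exact tendsto_nhds_unique h1 h2

/-- Decoupling of independent variables. -/
lemma ProbabilityTheory.IndepFun.lintegral_comp [IsProbabilityMeasure P] {α β : Type*} [MeasurableSpace α]
    [MeasurableSpace β] {U : Ω → α} {V : Ω → β} (h : IndepFun U V P) (hU : Measurable U)
    (hV : Measurable V) {f : α → β → ℝ≥0∞} (hf : Measurable (Function.uncurry f)) :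
    ∫⁻ ω, f (U ω) (V ω) ∂P = ∫⁻ ω, ∫⁻ ω', f (U ω) (V ω') ∂P ∂P := by
  have h1 := (indepFun_iff_map_prod_eq_prod_map_map hU.aemeasurable hV.aemeasurable).1 h
  have : SFinite (P.map V) := inferInstance
  calc ∫⁻ ω, f (U ω) (V ω) ∂P = ∫⁻ p, Function.uncurry f p ∂(P.map fun ω => (U ω, V ω)) := by
        rw [lintegral_map hf (hU.prodMk hV)]; rfl
    _ = ∫⁻ a, ∫⁻ b, f a b ∂(P.map V) ∂(P.map U) := by
        rw [h1, lintegral_prod _ hf.aemeasurable]; rfl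
    _ = _ := by
        rw [lintegral_map (f := fun a => ∫⁻ b, f a b ∂(P.map V)) hf.lintegral_prod_right' hU]
        refine lintegral_congr fun ω => ?_
        rw [lintegral_map (f := f (U ω)) (hf.comp measurable_prodMk_left) hV]

/-- Conditional form of `lintegral_expNeg_tsum`: `U` carries the upper levels of the tree and is
frozen while the last-level variables `W i` are averaged one by one. -/
lemma lintegral_expNeg_tsum_of_indepFun [IsProbabilityMeasure P] {ι α β : Type*} [Countable ι]
    [MeasurableSpace α] [MeasurableSpace β] {U : Ω → α} {W : ι → Ω → β}
    (hUW : IndepFun U (fun ω i => W i ω) P) (hind : iIndepFun W P) (hU : Measurable U)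
    (hW : ∀ i, Measurable (W i)) {Φ : ι → α → β → ℝ≥0∞} {c : ι → α → ℝ≥0∞}
    (hΦ : ∀ i, Measurable (Function.uncurry (Φ i)))
    (hc : ∀ i y, ∫⁻ ω, expNeg (Φ i y (W i ω)) ∂P = expNeg (c i y)) :
    ∫⁻ ω, expNeg (∑' i, Φ i (U ω) (W i ω)) ∂P = ∫⁻ ω, expNeg (∑' i, c i (U ω)) ∂P := by
  have hm : Measurable (Function.uncurry fun y (w : ι → β) => expNeg (∑' i, Φ i y (w i))) :=
    measurable_expNeg.comp (Measurable.tsum fun i => (hΦ i).comp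
      (measurable_fst.prodMk ((measurable_pi_apply i).comp measurable_snd)))
  rw [hUW.lintegral_comp hU (measurable_pi_lambda _ hW) hm]
  refine lintegral_congr fun ω => ?_
  exact lintegral_expNeg_tsum (fun i => ((hΦ i).comp measurable_prodMk_left).comp (hW i))
    (hind.comp (fun i => Φ i (U ω)) fun i => (hΦ i).comp measurable_prodMk_left)
    fun i => hc i (U ω)

/-- Functions of disjoint subfamilies of an independent family are independent. -/
lemma ProbabilityTheory.iIndepFun.indepFun_of_disjoint {ι : Type*} {β : ι → Type*}
    [mβ : ∀ i, MeasurableSpace (β i)] {f : ∀ i, Ω → β i} (hf : iIndepFun f P)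
    (hm : ∀ i, Measurable (f i)) {S T : Set ι} (hST : Disjoint S T) {α γ : Type*}
    [mα : MeasurableSpace α] [mγ : MeasurableSpace γ] {U : Ω → α} {V : Ω → γ}
    (hU : Measurable[⨆ i ∈ S, (mβ i).comap (f i)] U)
    (hV : Measurable[⨆ i ∈ T, (mβ i).comap (f i)] V) : IndepFun U V P := by
  have h := indep_iSup_of_disjoint (fun i => (hm i).comap_le) hf hST
  exact indep_of_indep_of_le_right (indep_of_indep_of_le_left h hU.comap_le) hV.comap_le

end Independence

/-! ### The Laplace functional of a Poisson process -/

section Poisson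

variable {Ω : Type*} [MeasurableSpace Ω] {P : Measure Ω} [IsProbabilityMeasure P]
  {Λ : Measure ℝ} {X : ℕ → Ω → ℝ}

lemma expNeg_natCast_mul (j : ℕ) (c : ℝ≥0∞) : expNeg (j * c) = expNeg c ^ j := by
  have := expNeg_sum (Finset.range j) fun _ => c
  simpa using this

lemma lintegral_poissonMeasure_pow (r : ℝ≥0) {p : ℝ≥0∞} (hp : p ≤ 1) :
    ∫⁻ j, p ^ j ∂(poissonMeasure r) = expNeg (r * (1 - p)) := by
  lift p to ℝ≥0 using (hp.trans_lt ENNReal.one_lt_top).ne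
  have hp1 : (p : ℝ) ≤ 1 := by exact_mod_cast hp
  rw [lintegral_countable']
  simp_rw [poissonMeasure_singleton]
  have h1 : ∀ j : ℕ, (p : ℝ≥0∞) ^ j * ENNReal.ofReal (Real.exp (-r) * r ^ j / (j.factorial : ℝ))
      = ENNReal.ofReal (Real.exp (-r) * ((r * p : ℝ) ^ j / (j.factorial : ℝ))) := by
    intro j
    rw [← ENNReal.coe_pow, ← ENNReal.ofReal_coe_nnreal, ← ENNReal.ofReal_mul (by positivity)]
    congr 1
    push_cast
    rw [mul_pow]
    ring
  simp_rw [h1]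
  have hs : HasSum (fun j : ℕ => Real.exp (-r) * ((r * p : ℝ) ^ j / (j.factorial : ℝ)))
      (Real.exp (-r) * Real.exp (r * p)) := by
    rw [Real.exp_eq_exp_ℝ]
    exact (NormedSpace.expSeries_div_hasSum_exp (r * p : ℝ)).mul_left _
  rw [← ENNReal.ofReal_tsum_of_nonneg (fun j => by positivity) hs.summable, hs.tsum_eq,
    ← Real.exp_add]
  have h2 : (r : ℝ≥0∞) * (1 - p) = ENNReal.ofReal (r * (1 - p)) := by
    rw [ENNReal.ofReal_mul (by positivity), ENNReal.ofReal_sub _ (by positivity)]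
    simp
  rw [h2, expNeg_ofReal (mul_nonneg r.coe_nonneg (sub_nonneg.2 hp1))]
  congr 2
  ring

lemma measurable_pointCount (hX : ∀ n, Measurable (X n)) {B : Set ℝ} (hB : MeasurableSet B) :
    Measurable fun ω => pointCount (fun n => X n ω) B :=
  Measurable.tsum fun n => (measurable_one.indicator hB).comp (hX n)

lemma IsPoissonProcess.lintegral_expNeg_count (h : IsPoissonProcess P Λ X) {B : Set ℝ}
    (hB : MeasurableSet B) (c : ℝ≥0∞) :
    ∫⁻ ω, expNeg (pointCount (fun n => X n ω) B * c) ∂P = expNeg (Λ B * (1 - expNeg c)) := by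
  have hm := measurable_pointCount h.measurable hB
  by_cases hΛ : Λ B = ∞
  · have h1 : ∫⁻ ω, expNeg (pointCount (fun n => X n ω) B * c) ∂P
        = ∫⁻ ω, expNeg (∞ * c) ∂P := by
      refine lintegral_congr_ae ?_
      filter_upwards [h.count_infinite B hB hΛ] with ω hω
      rw [hω]
    rw [h1, hΛ]
    by_cases hc : c = 0
    · simp [hc]
    -- For `c > 0` both sides vanish, since both exponents are infinite.
    · have : 1 - expNeg c ≠ 0 := by
        rw [← pos_iff_ne_zero, tsub_pos_iff_lt, ← expNeg_zero]
        refine lt_of_le_of_ne (expNeg_antitone (zero_le (a := c))) fun h => hc ?_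
        have := EReal.exp_strictMono.injective h
        simpa using this
      simp [ENNReal.top_mul hc, ENNReal.top_mul this]
  · have h1 : ∫⁻ ω, expNeg (pointCount (fun n => X n ω) B * c) ∂P
        = ∫⁻ z, expNeg (z * c) ∂(P.map fun ω => pointCount (fun n => X n ω) B) := by
      rw [lintegral_map (by fun_prop) hm]
    rw [h1, h.count_law B hB hΛ, lintegral_map (by fun_prop) (by fun_prop)]
    simp_rw [expNeg_natCast_mul]
    rw [lintegral_poissonMeasure_pow _ (expNeg_le_one c), ENNReal.coe_toNNReal hΛ]

lemma tsum_simpleFunc (φ : SimpleFunc ℝ ℝ≥0∞) (u : ℕ → ℝ) :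
    ∑' n, φ (u n) = ∑ c ∈ φ.range, pointCount u (φ ⁻¹' {c}) * c := by
  classical
  have h1 : ∀ n, φ (u n) = ∑ c ∈ φ.range, (φ ⁻¹' {c}).indicator 1 (u n) * c := by
    intro n
    rw [Finset.sum_eq_single (φ (u n))]
    · simp
    · intro c _ hc
      rw [Set.indicator_of_notMem, zero_mul]
      simpa using hc.symm
    · intro h
      exact absurd (SimpleFunc.mem_range_self φ (u n)) h
  simp_rw [h1, pointCount, ← ENNReal.tsum_mul_right]
  rw [Summable.tsum_finsetSum fun _ _ => ENNReal.summable]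

/-- The sum is a finite combination of the counts of the disjoint level sets of `φ`, which are
independent. -/
lemma IsPoissonProcess.lintegral_expNeg_simpleFunc (h : IsPoissonProcess P Λ X)
    (φ : SimpleFunc ℝ ℝ≥0∞) :
    ∫⁻ ω, expNeg (∑' n, φ (X n ω)) ∂P = expNeg (∫⁻ u, (1 - expNeg (φ u)) ∂Λ) := by
  classical
  let e := φ.range.equivFin
  let b : Fin φ.range.card → ℝ≥0∞ := fun i => (e.symm i : ℝ≥0∞)
  have hb : Function.Injective b := Subtype.val_injective.comp e.symm.injective
  have hsum : ∀ f : ℝ≥0∞ → ℝ≥0∞, ∑ c ∈ φ.range, f c = ∑ i, f (b i) := by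
    intro f
    rw [← Finset.sum_coe_sort, ← e.symm.sum_comp]
  have hind := h.indep _ (fun i => φ ⁻¹' {b i}) (fun i => φ.measurableSet_preimage _) (by
    intro i j hij
    refine Disjoint.preimage _ ?_
    simpa using fun h => hij (hb h))
  have key := lintegral_expNeg_tsum (P := P)
    (Y := fun i ω => pointCount (fun n => X n ω) (φ ⁻¹' {b i}) * b i)
    (c := fun i => Λ (φ ⁻¹' {b i}) * (1 - expNeg (b i)))
    (fun i => (measurable_pointCount h.measurable (φ.measurableSet_preimage _)).mul_const _)
    (hind.comp (fun i z => z * b i) fun i => by fun_prop)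
    (fun i => h.lintegral_expNeg_count (φ.measurableSet_preimage _) _)
  simp_rw [tsum_fintype] at key
  simp_rw [tsum_simpleFunc, hsum]
  rw [key]
  congr 1
  have h2 : ∫⁻ u, (1 - expNeg (φ u)) ∂Λ = (φ.map fun c => 1 - expNeg c).lintegral Λ := by
    rw [← SimpleFunc.lintegral_eq_lintegral]; rfl
  rw [h2, SimpleFunc.map_lintegral, hsum]
  exact Finset.sum_congr rfl fun i _ => mul_comm _ _

/-- The Laplace functional of a Poisson process. -/
lemma IsPoissonProcess.lintegral_expNeg (h : IsPoissonProcess P Λ X) {φ : ℝ → ℝ≥0∞}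
    (hφ : Measurable φ) :
    ∫⁻ ω, expNeg (∑' n, φ (X n ω)) ∂P = expNeg (∫⁻ u, (1 - expNeg (φ u)) ∂Λ) := by
  -- Approximate `φ` from below by simple functions: the left side converges by dominated
  -- convergence, the exponent on the right by monotone convergence.
  let F := fun j => SimpleFunc.eapprox φ j
  have hlim : ∀ u, Tendsto (fun j => F j u) atTop (𝓝 (φ u)) := fun u => by
    rw [← SimpleFunc.iSup_eapprox_apply hφ u]
    exact tendsto_atTop_iSup fun i j hij => SimpleFunc.monotone_eapprox φ hij u
  have h1 : Tendsto (fun j => ∫⁻ ω, expNeg (∑' n, F j (X n ω)) ∂P) atTop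
      (𝓝 (∫⁻ ω, expNeg (∑' n, φ (X n ω)) ∂P)) := by
    refine tendsto_lintegral_of_dominated_convergence (fun _ => 1) (fun j => ?_)
      (fun j => Eventually.of_forall fun ω => expNeg_le_one _) (by simp)
      (Eventually.of_forall fun ω => (continuous_expNeg.tendsto _).comp ?_)
    · exact measurable_expNeg.comp
        (Measurable.tsum fun n => (F j).measurable.comp (h.measurable n))
    · simp_rw [← lintegral_count]
      exact lintegral_tendsto_of_tendsto_of_monotone (fun j => measurable_of_countable _ |>.aemeasurable)
        (Eventually.of_forall fun n i j hij => SimpleFunc.monotone_eapprox φ hij _)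
        (Eventually.of_forall fun n => hlim _)
  have h2 : Tendsto (fun j => expNeg (∫⁻ u, (1 - expNeg (F j u)) ∂Λ)) atTop
      (𝓝 (expNeg (∫⁻ u, (1 - expNeg (φ u)) ∂Λ))) := by
    refine (continuous_expNeg.tendsto _).comp ?_
    refine lintegral_tendsto_of_tendsto_of_monotone
      (fun j => (measurable_const.sub (measurable_expNeg.comp (F j).measurable)).aemeasurable)
      (Eventually.of_forall fun u i j hij => tsub_le_tsub_left
        (expNeg_antitone (SimpleFunc.monotone_eapprox φ hij u)) 1)
      (Eventually.of_forall fun u => ?_)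
    exact ENNReal.Tendsto.sub tendsto_const_nhds
      ((continuous_expNeg.tendsto _).comp (hlim u)) (Or.inl ENNReal.one_ne_top)
  have h3 : ∀ j, ∫⁻ ω, expNeg (∑' n, F j (X n ω)) ∂P = expNeg (∫⁻ u, (1 - expNeg (F j u)) ∂Λ) :=
    fun j => h.lintegral_expNeg_simpleFunc (F j)
  simp_rw [h3] at h1
  exact tendsto_nhds_unique h1 h2

end Poisson

/-! ### Integrals against exponential intensities -/

/-- Translation by `s / b`. This self-similarity of the exponential density produces the ratios of
consecutive parameters in the recursion. -/
lemma lintegral_shift_mul_exp (φ : ℝ → ℝ≥0∞) (s m : ℝ) {b : ℝ} (hb : b ≠ 0) :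
    ∫⁻ u, φ (s + b * u) * ENNReal.ofReal (Real.exp (-(m * u)))
      = ENNReal.ofReal (Real.exp (m / b * s))
        * ∫⁻ u, φ (b * u) * ENNReal.ofReal (Real.exp (-(m * u))) := by
  rw [← lintegral_const_mul' _ _ ENNReal.ofReal_ne_top,
    ← lintegral_add_right_eq_self (fun u => ENNReal.ofReal (Real.exp (m / b * s))
      * (φ (b * u) * ENNReal.ofReal (Real.exp (-(m * u))))) (s / b)]
  refine lintegral_congr fun u => ?_
  have h1 : b * (u + s / b) = s + b * u := by field_simp; ring
  have h2 : Real.exp (-(m * u)) = Real.exp (m / b * s) * Real.exp (-(m * (u + s / b))) := by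
    rw [← Real.exp_add]
    congr 1
    field_simp
    ring
  rw [h1, h2, ENNReal.ofReal_mul (Real.exp_pos _).le]
  ring

lemma integrable_exp_neg_mul_abs {c : ℝ} (hc : 0 < c) :
    Integrable fun u : ℝ => Real.exp (-(c * |u|)) := by
  rw [← integrableOn_univ, ← Iic_union_Ioi (a := (0 : ℝ)), integrableOn_union]
  constructor
  · refine (integrableOn_exp_mul_Iic hc 0).congr_fun (fun u hu => ?_) measurableSet_Iic
    simp [abs_of_nonpos (show u ≤ 0 from hu)]
  · refine (exp_neg_integrableOn_Ioi 0 hc).congr_fun (fun u hu => ?_) measurableSet_Ioi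
    simp [abs_of_pos (show 0 < u from hu)]

lemma lintegral_lt_top_of_le_exp_neg_mul_abs {f : ℝ → ℝ≥0∞} {c : ℝ} (hc : 0 < c)
    (hf : ∀ u, f u ≤ ENNReal.ofReal (Real.exp (-(c * |u|)))) : ∫⁻ u, f u < ∞ :=
  (lintegral_mono hf).trans_lt (integrable_exp_neg_mul_abs hc).lintegral_lt_top

lemma one_sub_expNeg_ofReal {r : ℝ} (hr : 0 ≤ r) :
    1 - expNeg (ENNReal.ofReal r) = ENNReal.ofReal (1 - Real.exp (-r)) := by
  rw [expNeg_ofReal hr, ENNReal.ofReal_sub _ (Real.exp_pos _).le, ENNReal.ofReal_one]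

/-- The integral `∫ (1 - e^{-e^{b u}}) e^{-m u} du`. -/
def upperConst (b m : ℝ) : ℝ≥0∞ :=
  ∫⁻ u, (1 - expNeg (ENNReal.ofReal (Real.exp (b * u)))) * ENNReal.ofReal (Real.exp (-(m * u)))

/-- The integral `∫ e^{-e^{b u}} e^{m u} du`. -/
def lowerConst (b m : ℝ) : ℝ≥0∞ :=
  ∫⁻ u, expNeg (ENNReal.ofReal (Real.exp (b * u))) * ENNReal.ofReal (Real.exp (-(-m * u)))

/-- On the right `e^{-m u}` decays; on the left `1 - e^{-e^{b u}} ≤ e^{b u}` leaves `e^{(b - m) u}`.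
Hence the rate `min m (b - m)`. -/
lemma upperConst_ne_top {b m : ℝ} (hm : 0 < m) (hmb : m < b) : upperConst b m ≠ ∞ := by
  refine (lintegral_lt_top_of_le_exp_neg_mul_abs (lt_min hm (sub_pos.2 hmb)) fun u => ?_).ne
  rw [one_sub_expNeg_ofReal (Real.exp_pos _).le, ← ENNReal.ofReal_mul' (Real.exp_pos _).le]
  refine ENNReal.ofReal_le_ofReal ?_
  rcases le_total 0 u with hu | hu
  · calc _ ≤ 1 * Real.exp (-(m * u)) := by
          gcongr
          linarith [Real.exp_pos (-Real.exp (b * u))]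
      _ ≤ _ := by
          rw [one_mul, abs_of_nonneg hu]
          gcongr
          exact min_le_left _ _
  · calc _ ≤ Real.exp (b * u) * Real.exp (-(m * u)) := by
          gcongr
          linarith [Real.add_one_le_exp (-Real.exp (b * u))]
      _ ≤ _ := by
          rw [← Real.exp_add, abs_of_nonpos hu]
          gcongr
          have := mul_le_mul_of_nonpos_right (min_le_right m (b - m)) hu
          linarith

/-- The crude bound `e^{-e^{b u}} ≤ e^{-b u}` on the right already suffices in the range `m < b`. -/
lemma lowerConst_ne_top {b m : ℝ} (hm : 0 < m) (hmb : m < b) : lowerConst b m ≠ ∞ := by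
  refine (lintegral_lt_top_of_le_exp_neg_mul_abs (lt_min hm (sub_pos.2 hmb)) fun u => ?_).ne
  rw [expNeg_ofReal (Real.exp_pos _).le, ← ENNReal.ofReal_mul' (Real.exp_pos _).le]
  refine ENNReal.ofReal_le_ofReal ?_
  rcases le_total 0 u with hu | hu
  · calc _ ≤ Real.exp (-(b * u)) * Real.exp (-(-m * u)) := by
          gcongr
          linarith [Real.add_one_le_exp (b * u)]
      _ ≤ _ := by
          rw [← Real.exp_add, abs_of_nonneg hu]
          gcongr
          have := mul_le_mul_of_nonneg_right (min_le_right m (b - m)) hu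
          linarith
  · calc _ ≤ 1 * Real.exp (-(-m * u)) := by
          gcongr
          exact Real.exp_le_one_iff.2 (neg_nonpos.2 (Real.exp_pos _).le)
      _ ≤ _ := by
          rw [one_mul, abs_of_nonpos hu, Real.exp_le_exp]
          have := mul_le_mul_of_nonpos_right (min_le_left m (b - m)) hu
          linarith

lemma lintegral_ne_zero_of_pos {f : ℝ → ℝ≥0∞} (hf : Measurable f) (h : ∀ u, f u ≠ 0) :
    ∫⁻ u, f u ≠ 0 := by
  intro h0
  rw [lintegral_eq_zero_iff hf] at h0
  obtain ⟨u, hu⟩ := h0.exists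
  exact h u hu

lemma upperConst_ne_zero (b m : ℝ) : upperConst b m ≠ 0 := by
  refine lintegral_ne_zero_of_pos (by fun_prop) fun u => ?_
  rw [one_sub_expNeg_ofReal (Real.exp_pos _).le, ← ENNReal.ofReal_mul' (Real.exp_pos _).le]
  refine (ENNReal.ofReal_pos.2 (mul_pos (sub_pos.2 ?_) (Real.exp_pos _))).ne'
  exact Real.exp_lt_one_iff.2 (neg_neg_of_pos (Real.exp_pos _))

lemma lowerConst_ne_zero (b m : ℝ) : lowerConst b m ≠ 0 := by
  refine lintegral_ne_zero_of_pos (by fun_prop) fun u => ?_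
  rw [expNeg_ofReal (Real.exp_pos _).le, ← ENNReal.ofReal_mul' (Real.exp_pos _).le]
  exact (ENNReal.ofReal_pos.2 (mul_pos (Real.exp_pos _) (Real.exp_pos _))).ne'

lemma lintegral_expIntensity {m : ℝ} (hm : 0 < m) {f : ℝ → ℝ≥0∞} (hf : Measurable f) :
    ∫⁻ u, f u ∂(expIntensity m)
      = ENNReal.ofReal m * ∫⁻ u, f u * ENNReal.ofReal (Real.exp (-(m * u))) := by
  rw [expIntensity, lintegral_withDensity_eq_lintegral_mul _ (by fun_prop) hf,
    ← lintegral_const_mul _ (by fun_prop)]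
  refine lintegral_congr fun u => ?_
  rw [Pi.mul_apply, ENNReal.ofReal_mul hm.le]
  ring

/-- As a function of `λ = e^s` this exponent is a multiple of `λ^{m / b}`: sums of `e^{b x_n}` over
the process are stable of index `m / b`. -/
lemma lintegral_expIntensity_one_sub_expNeg {m b : ℝ} (hm : 0 < m) (hb : b ≠ 0) (s : ℝ) :
    ∫⁻ u, (1 - expNeg (ENNReal.ofReal (Real.exp (s + b * u)))) ∂(expIntensity m)
      = ENNReal.ofReal m * upperConst b m * ENNReal.ofReal (Real.exp (m / b * s)) := by
  rw [lintegral_expIntensity hm (by fun_prop),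
    lintegral_shift_mul_exp (fun v => 1 - expNeg (ENNReal.ofReal (Real.exp v))) s m hb, upperConst]
  ring

instance (m : ℝ) : SFinite (expIntensity m) := by unfold expIntensity; infer_instance

/-- A random variable whose Laplace transform is that of a stable law has the moments of orders
`c` in `(0, b)`. -/
lemma lintegral_exp_mul_of_stable {Ω : Type*} [MeasurableSpace Ω] {P : Measure Ω} [SFinite P]
    {Y : Ω → ℝ} (hY : Measurable Y) {b K : ℝ} (hb : 0 < b)
    (hL : ∀ s, ∫⁻ ω, expNeg (ENNReal.ofReal (Real.exp (s + Y ω))) ∂P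
      = expNeg (ENNReal.ofReal (Real.exp (K + b * s)))) (hP : P univ = 1) {c : ℝ} :
    upperConst 1 c * ∫⁻ ω, ENNReal.ofReal (Real.exp (c * Y ω)) ∂P
      = upperConst b c * ENNReal.ofReal (Real.exp (c / b * K)) := by
  have hL' : ∀ s, ∫⁻ ω, (1 - expNeg (ENNReal.ofReal (Real.exp (s + Y ω)))) ∂P
      = 1 - expNeg (ENNReal.ofReal (Real.exp (K + b * s))) := by
    intro s
    rw [lintegral_sub (by fun_prop) (by rw [hL]; exact expNeg_ne_top _)
      (Eventually.of_forall fun ω => expNeg_le_one _), hL, lintegral_const, hP, one_mul]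
  -- Integrate `hL'` against `e^{-c s} ds`. The right side is a shift by `K`; on the left, Tonelli
  -- and a shift by `Y ω` bring out `e^{c Y}`. The identity holds in `[0, ∞]`, so no finiteness is
  -- needed.
  have h1 := lintegral_shift_mul_exp (fun v => 1 - expNeg (ENNReal.ofReal (Real.exp v))) K c hb.ne'
  simp_rw [← hL'] at h1
  rw [upperConst, upperConst, mul_comm (lintegral _ _) (ENNReal.ofReal _), ← h1]
  simp_rw [← lintegral_mul_const' _ _ (ENNReal.ofReal_ne_top)]
  rw [lintegral_lintegral_swap (by fun_prop), ← lintegral_const_mul _ (by fun_prop)]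
  refine lintegral_congr fun ω => ?_
  have h2 := lintegral_shift_mul_exp (fun v => 1 - expNeg (ENNReal.ofReal (Real.exp v))) (Y ω) c
    one_ne_zero
  simp only [one_mul, div_one] at h2 ⊢
  simp_rw [add_comm _ (Y ω), h2]
  ring

/-- A random variable whose Laplace transform is that of a stable law has all negative moments. -/
lemma lintegral_exp_neg_mul_of_stable {Ω : Type*} [MeasurableSpace Ω] {P : Measure Ω} [SFinite P]
    {Y : Ω → ℝ} (hY : Measurable Y) {b K : ℝ} (hb : 0 < b)
    (hL : ∀ s, ∫⁻ ω, expNeg (ENNReal.ofReal (Real.exp (s + Y ω))) ∂P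
      = expNeg (ENNReal.ofReal (Real.exp (K + b * s)))) {c : ℝ} :
    lowerConst 1 c * ∫⁻ ω, ENNReal.ofReal (Real.exp (-c * Y ω)) ∂P
      = lowerConst b c * ENNReal.ofReal (Real.exp (-c / b * K)) := by
  have h1 := lintegral_shift_mul_exp (fun v => expNeg (ENNReal.ofReal (Real.exp v))) K (-c) hb.ne'
  simp_rw [← hL] at h1
  rw [lowerConst, lowerConst, mul_comm (lintegral _ _) (ENNReal.ofReal _), ← h1]
  simp_rw [← lintegral_mul_const' _ _ (ENNReal.ofReal_ne_top)]
  rw [lintegral_lintegral_swap (by fun_prop), ← lintegral_const_mul _ (by fun_prop)]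
  refine lintegral_congr fun ω => ?_
  have h2 := lintegral_shift_mul_exp (fun v => expNeg (ENNReal.ofReal (Real.exp v))) (Y ω) (-c)
    one_ne_zero
  simp only [one_mul, div_one] at h2 ⊢
  simp_rw [add_comm _ (Y ω), h2]
  ring

/-! ### The backward recursion -/

lemma integrable_exp_mul_abs_gaussianReal (B : ℝ) :
    Integrable (fun y => Real.exp (B * |y|)) (gaussianReal 0 1) :=
  integrable_exp_mul_abs (X := id) (integrable_exp_mul_gaussianReal B)
    (integrable_exp_mul_gaussianReal (-B))

/-- A bound for the growth of the constant in one step of the recursion. -/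
def growthConst (B : ℝ) : ℝ := ∫ y, Real.exp (2 * B * |y|) ∂(gaussianReal 0 1)

/-- Dominates the quotients `(e^{a φ} - 1) / a` uniformly in `a ∈ (0, 1]` when `a → 0`. -/
lemma abs_exp_sub_one_le_abs_mul_exp (x : ℝ) :
    |Real.exp x - 1| ≤ |x| * Real.exp |x| := by
  rcases le_total 0 x with hx | hx
  · rw [abs_of_nonneg hx, abs_of_nonneg (sub_nonneg.2 (Real.one_le_exp hx))]
    have h : Real.exp x * (1 - x) ≤ 1 := by
      calc _ ≤ Real.exp x * Real.exp (-x) := by gcongr; linarith [Real.add_one_le_exp (-x)]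
        _ = 1 := by rw [← Real.exp_add]; simp
    linarith
  · rw [abs_of_nonpos hx, abs_of_nonpos (sub_nonpos.2 (Real.exp_le_one_iff.2 hx))]
    have h := le_mul_of_one_le_right (neg_nonneg.2 hx) (Real.one_le_exp (neg_nonneg.2 hx))
    linarith [Real.add_one_le_exp x]

/-! ### One step of the recursion: growth and continuity -/

section Step

variable {A B a : ℝ} {φ : ℝ → ℝ}

lemma integrable_exp_of_growth (hφ : Measurable φ) (hb : ∀ y, φ y ≤ A + B * |y|) :
    Integrable (fun y => Real.exp (φ y)) (gaussianReal 0 1) := by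
  refine ((integrable_exp_mul_abs_gaussianReal B).const_mul (Real.exp A)).mono'
    (by fun_prop) (Eventually.of_forall fun y => ?_)
  rw [Real.norm_eq_abs, Real.abs_exp, ← Real.exp_add]
  exact Real.exp_le_exp.2 (hb y)

lemma integrable_exp_mul_of_growth (hφ : Measurable φ) (hb : ∀ y, |φ y| ≤ A + B * |y|) (a : ℝ) :
    Integrable (fun y => Real.exp (a * φ y)) (gaussianReal 0 1) := by
  refine integrable_exp_of_growth (A := |a| * A) (B := |a| * B) (by fun_prop) fun y => ?_
  calc a * φ y ≤ |a| * |φ y| := by rw [← abs_mul]; exact le_abs_self _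
    _ ≤ |a| * (A + B * |y|) := by gcongr; exact hb y
    _ = _ := by ring

lemma integrable_of_growth (hφ : Measurable φ) (hb : ∀ y, |φ y| ≤ A + B * |y|) :
    Integrable φ (gaussianReal 0 1) := by
  refine (integrable_exp_of_growth (φ := fun y => |φ y|) (by fun_prop) hb).mono'
    (by fun_prop) (Eventually.of_forall fun y => ?_)
  rw [Real.norm_eq_abs]
  linarith [Real.add_one_le_exp |φ y|]

lemma exp_mul_parisiStep (hφ : Measurable φ) (hb : ∀ y, |φ y| ≤ A + B * |y|) (ha : a ≠ 0) :
    Real.exp (a * parisiStep a φ) = ∫ y, Real.exp (a * φ y) ∂(gaussianReal 0 1) := by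
  rw [parisiStep, if_neg ha, ← mul_assoc, mul_one_div_cancel ha, one_mul, Real.exp_log]
  exact integral_exp_pos (integrable_exp_mul_of_growth hφ hb a)

lemma integral_growth_le (hB : 0 ≤ B) :
    ∫ y, (A + B * |y|) ∂(gaussianReal 0 1) ≤ A + growthConst B := by
  have h1 : Integrable (fun y : ℝ => B * |y|) (gaussianReal 0 1) :=
    integrable_of_growth (A := 0) (B := B) (by fun_prop) fun y => by
      rw [abs_of_nonneg (by positivity)]; simp
  rw [integral_add (integrable_const _) h1, integral_const]
  simp only [probReal_univ, one_smul, add_le_add_iff_left, growthConst]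
  refine integral_mono h1 (integrable_exp_mul_abs_gaussianReal _) fun y => ?_
  have := Real.add_one_le_exp (2 * B * |y|)
  have h2 : 0 ≤ B * |y| := by positivity
  simp only
  linarith

lemma abs_integral_le_of_growth (hB : 0 ≤ B) (hφ : Measurable φ)
    (hb : ∀ y, |φ y| ≤ A + B * |y|) :
    |∫ y, φ y ∂(gaussianReal 0 1)| ≤ A + growthConst B := by
  refine (abs_integral_le_integral_abs).trans ((integral_mono (integrable_of_growth hφ hb).abs ?_ hb).trans
    (integral_growth_le hB))
  have h1 : Integrable (fun y : ℝ => B * |y|) (gaussianReal 0 1) :=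
    integrable_of_growth (A := 0) (B := B) (by fun_prop) fun y => by
      rw [abs_of_nonneg (by positivity)]; simp
  exact (integrable_const A).add h1

/-- The lower bound is Jensen's inequality. The upper bound must not blow up as `a → 0`: with `Y = B
|y|`, `e^{a Y} ≤ 1 + a Y e^{a Y} ≤ 1 + a e^{2 Y}`, and the factor `a` compensates `1 / a` in front
of the logarithm. -/
lemma abs_parisiStep_le (hB : 0 ≤ B) (hφ : Measurable φ) (hb : ∀ y, |φ y| ≤ A + B * |y|)
    (ha0 : 0 ≤ a) (ha1 : a ≤ 1) : |parisiStep a φ| ≤ A + growthConst B := by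
  have hI := abs_integral_le_of_growth hB hφ hb
  rcases ha0.eq_or_lt with rfl | ha
  · simpa [parisiStep] using hI
  have hint := integrable_exp_mul_of_growth hφ hb a
  have hexp := exp_mul_parisiStep hφ hb ha.ne'
  set c := ∫ y, φ y ∂(gaussianReal 0 1) with hc
  have hφi := integrable_of_growth hφ hb
  rw [abs_le]
  constructor
  · have h1 : Real.exp (a * c) ≤ Real.exp (a * parisiStep a φ) := by
      rw [hexp]
      -- The tangent line of `exp` at `a * c`, whose linear term has mean zero because `c` is the
      -- mean of `φ`.
      have h2 : ∫ y, Real.exp (a * c) * (1 + a * (φ y - c)) ∂(gaussianReal 0 1)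
          = Real.exp (a * c) := by
        rw [integral_const_mul, integral_add (integrable_const _) (by fun_prop),
          integral_const_mul, integral_sub hφi (integrable_const _)]
        simp [← hc]
      rw [← h2]
      refine integral_mono (by fun_prop) hint fun y => ?_
      have h3 : Real.exp (a * φ y) = Real.exp (a * c) * Real.exp (a * (φ y - c)) := by
        rw [← Real.exp_add]; congr 1; ring
      simp only
      rw [h3]
      gcongr
      linarith [Real.add_one_le_exp (a * (φ y - c))]
    have h4 := le_of_mul_le_mul_left (Real.exp_le_exp.1 h1) ha
    linarith [neg_le_of_abs_le hI]
  · have h1 : Real.exp (a * parisiStep a φ) ≤ Real.exp (a * A) * (1 + a * growthConst B) := by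
      have hg := (integrable_exp_mul_abs_gaussianReal (2 * B)).const_mul a
      rw [hexp, growthConst, ← integral_const_mul a]
      have h5 : (1 : ℝ) + ∫ y, a * Real.exp (2 * B * |y|) ∂(gaussianReal 0 1)
          = ∫ y, (1 + a * Real.exp (2 * B * |y|)) ∂(gaussianReal 0 1) := by
        rw [integral_add (integrable_const _) hg]; simp
      rw [h5, ← integral_const_mul]
      refine integral_mono hint (((integrable_const _).add hg).const_mul _) fun y => ?_
      simp only
      set Y := B * |y| with hY
      have hY0 : 0 ≤ Y := by positivity
      calc Real.exp (a * φ y) ≤ Real.exp (a * A + a * Y) := by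
            rw [← mul_add]; gcongr; exact (abs_le.1 (hb y)).2
        _ = Real.exp (a * A) * Real.exp (a * Y) := Real.exp_add _ _
        _ ≤ Real.exp (a * A) * (1 + a * Real.exp (2 * B * |y|)) := by
            gcongr
            have h6 : Real.exp (a * Y) * (1 - a * Y) ≤ 1 := by
              calc _ ≤ Real.exp (a * Y) * Real.exp (-(a * Y)) := by
                    gcongr; linarith [Real.add_one_le_exp (-(a * Y))]
                _ = 1 := by rw [← Real.exp_add]; simp
            have h7 : Y * Real.exp (a * Y) ≤ Real.exp (2 * B * |y|) := by
              calc Y * Real.exp (a * Y) ≤ Real.exp Y * Real.exp Y := by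
                    gcongr
                    · linarith [Real.add_one_le_exp Y]
                    · exact mul_le_of_le_one_left hY0 ha1
                _ = _ := by rw [← Real.exp_add]; congr 1; rw [hY]; ring
            have h8 := mul_le_mul_of_nonneg_left h7 ha.le
            nlinarith
    have h2 : Real.exp (a * A) * (1 + a * growthConst B) ≤ Real.exp (a * (A + growthConst B)) := by
      rw [mul_add a, Real.exp_add]
      gcongr
      linarith [Real.add_one_le_exp (a * growthConst B)]
    exact le_of_mul_le_mul_left (Real.exp_le_exp.1 (h1.trans h2)) ha

/-- Dominated convergence with the uniform growth bound. At `a = 0` the expression is of the form `0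
/ 0`; `dslope` rewrites the difference quotients of `exp` and `log` as functions continuous at the
base point. -/
lemma tendsto_parisiStep {φs : ℕ → ℝ → ℝ} {as : ℕ → ℝ} (hφ : ∀ n, Measurable (φs n))
    (hb : ∀ n y, |φs n y| ≤ A + B * |y|) (hlim : ∀ y, Tendsto (fun n => φs n y) atTop (𝓝 (φ y)))
    (has0 : ∀ n, 0 < as n) (has1 : ∀ n, as n ≤ 1) (ha : Tendsto as atTop (𝓝 a)) :
    Tendsto (fun n => parisiStep (as n) (φs n)) atTop (𝓝 (parisiStep a φ)) := by
  have hφm : Measurable φ := measurable_of_tendsto_metrizable hφ (tendsto_pi_nhds.2 hlim)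
  have hφb : ∀ y, |φ y| ≤ A + B * |y| := fun y =>
    le_of_tendsto (hlim y).abs (Eventually.of_forall fun n => hb n y)
  have hstep : ∀ n, parisiStep (as n) (φs n)
      = 1 / as n * Real.log (∫ y, Real.exp (as n * φs n y) ∂(gaussianReal 0 1)) := fun n => by
    rw [parisiStep, if_neg (has0 n).ne']
  simp_rw [hstep]
  have hE : ∀ n y, Real.exp (as n * φs n y) ≤ Real.exp (A + B * |y|) := fun n y => by
    refine Real.exp_le_exp.2 ?_
    calc as n * φs n y ≤ as n * |φs n y| := by
          gcongr
          · exact (has0 n).le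
          · exact le_abs_self _
      _ ≤ 1 * |φs n y| := by gcongr; exact has1 n
      _ ≤ _ := by rw [one_mul]; exact hb n y
  by_cases ha0 : a = 0
  · subst ha0
    have hu : Tendsto (fun n => ∫ y, φs n y * dslope Real.exp 0 (as n * φs n y) ∂(gaussianReal 0 1))
        atTop (𝓝 (∫ y, φ y ∂(gaussianReal 0 1))) := by
      have hds : ∀ n y, φs n y * dslope Real.exp 0 (as n * φs n y)
          = (Real.exp (as n * φs n y) - 1) / as n := by
        intro n y
        have := sub_smul_dslope Real.exp 0 (as n * φs n y)
        simp only [sub_zero, smul_eq_mul, Real.exp_zero] at this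
        rw [← this]
        field_simp [(has0 n).ne']
      refine tendsto_integral_of_dominated_convergence
        (fun y => Real.exp (2 * A + 2 * B * |y|)) (fun n => ?_)
        (integrable_exp_of_growth (by fun_prop) fun y => le_rfl) (fun n => ?_) ?_
      · simp_rw [hds]
        have := hφ n
        fun_prop
      · refine Eventually.of_forall fun y => ?_
        rw [hds, Real.norm_eq_abs, abs_div, abs_of_pos (has0 n), div_le_iff₀ (has0 n)]
        set w := φs n y
        have hw := hb n y
        have e1 := abs_exp_sub_one_le_abs_mul_exp (as n * w)
        have e2 : |as n * w| = as n * |w| := by rw [abs_mul, abs_of_pos (has0 n)]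
        have e3 : as n * |w| ≤ |w| := mul_le_of_le_one_left (abs_nonneg _) (has1 n)
        calc _ ≤ as n * |w| * Real.exp (as n * |w|) := by rw [← e2]; exact e1
          _ ≤ as n * Real.exp |w| * Real.exp |w| := by
              have := (has0 n).le
              gcongr
              linarith [Real.add_one_le_exp |w|]
          _ = Real.exp (|w| + |w|) * as n := by rw [Real.exp_add]; ring
          _ ≤ _ := by
              refine mul_le_mul_of_nonneg_right (Real.exp_le_exp.2 ?_) (has0 n).le
              linarith
      · refine Eventually.of_forall fun y => ?_
        have hc : ContinuousAt (dslope Real.exp 0) 0 :=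
          continuousAt_dslope_same.2 Real.differentiableAt_exp
        have h1 : Tendsto (fun n => as n * φs n y) atTop (𝓝 0) := by
          simpa using ha.mul (hlim y)
        have h2 := (hlim y).mul (hc.tendsto.comp h1)
        simpa using h2
    have hint : ∀ n, ∫ y, Real.exp (as n * φs n y) ∂(gaussianReal 0 1)
        = 1 + as n * ∫ y, φs n y * dslope Real.exp 0 (as n * φs n y) ∂(gaussianReal 0 1) := by
      intro n
      have hds : ∀ y, as n * (φs n y * dslope Real.exp 0 (as n * φs n y))
          = Real.exp (as n * φs n y) - 1 := by
        intro y
        have := sub_smul_dslope Real.exp 0 (as n * φs n y)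
        simp only [sub_zero, smul_eq_mul, Real.exp_zero] at this
        rw [← this, mul_assoc]
      rw [← integral_const_mul]
      simp_rw [hds]
      rw [integral_sub (integrable_exp_mul_of_growth (hφ n) (hb n) _) (integrable_const _)]
      simp
    set u := fun n => ∫ y, φs n y * dslope Real.exp 0 (as n * φs n y) ∂(gaussianReal 0 1) with hudef
    -- The same device for `log` at `1`: `log (1 + a u) / a` is `u` times a factor tending to `1`.
    have hlog : ∀ n, 1 / as n * Real.log (1 + as n * u n)
        = u n * dslope Real.log 1 (1 + as n * u n) := by
      intro n
      have := sub_smul_dslope Real.log 1 (1 + as n * u n)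
      simp only [add_sub_cancel_left, smul_eq_mul, Real.log_one, sub_zero] at this
      rw [← this]
      field_simp [(has0 n).ne']
    have hc : ContinuousAt (dslope Real.log 1) 1 :=
      continuousAt_dslope_same.2 (Real.differentiableAt_log one_ne_zero)
    have h1 : Tendsto (fun n => 1 + as n * u n) atTop (𝓝 1) := by
      simpa using tendsto_const_nhds.add (ha.mul hu)
    have h2 := hu.mul (hc.tendsto.comp h1)
    simp_rw [hint]
    change Tendsto (fun n => 1 / as n * Real.log (1 + as n * u n)) _ _
    simp_rw [hlog]
    simpa [parisiStep] using h2
  · have h1 : Tendsto (fun n => ∫ y, Real.exp (as n * φs n y) ∂(gaussianReal 0 1)) atTop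
        (𝓝 (∫ y, Real.exp (a * φ y) ∂(gaussianReal 0 1))) := by
      refine tendsto_integral_of_dominated_convergence (fun y => Real.exp (A + B * |y|))
        (fun n => ?_) (integrable_exp_of_growth (by fun_prop) fun y => le_rfl) (fun n => ?_) ?_
      · have := hφ n
        fun_prop
      · refine Eventually.of_forall fun y => ?_
        rw [Real.norm_eq_abs, Real.abs_exp]
        exact hE n y
      · exact Eventually.of_forall fun y => (ha.mul (hlim y)).rexp
    rw [parisiStep, if_neg ha0]
    refine (tendsto_const_nhds.div ha ha0).mul (h1.log ?_)
    exact (integral_exp_pos (integrable_exp_mul_of_growth hφm hφb a)).ne'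

end Step

/-! ### Linear growth and continuity of the full recursion -/

/-- Measurable functions of at most linear growth. -/
structure LinearGrowth {k : ℕ} (A B : ℝ) (F : (Fin k → ℝ) → ℝ) : Prop where
  measurable : Measurable F
  nonneg : 0 ≤ B
  bound : ∀ x, |F x| ≤ A + B * ∑ i, |x i|

@[fun_prop]
lemma measurable_snoc {k : ℕ} :
    Measurable fun p : (Fin k → ℝ) × ℝ => (Fin.snoc (α := fun _ => ℝ) p.1 p.2 : Fin (k + 1) → ℝ) := by
  refine measurable_pi_lambda _ fun i => ?_
  refine Fin.lastCases ?_ (fun i => ?_) i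
  · simpa using measurable_snd
  · simp only [Fin.snoc_castSucc]
    exact (measurable_pi_apply i).comp measurable_fst

namespace LinearGrowth

variable {k : ℕ} {A B : ℝ}

lemma comp_snoc {F : (Fin (k + 1) → ℝ) → ℝ} (hF : LinearGrowth A B F) (x : Fin k → ℝ) :
    Measurable (fun y => F (Fin.snoc (α := fun _ => ℝ) x y)) ∧
      ∀ y, |F (Fin.snoc (α := fun _ => ℝ) x y)| ≤ (A + B * ∑ i, |x i|) + B * |y| := by
  refine ⟨hF.measurable.comp (measurable_snoc.comp measurable_prodMk_left), fun y => ?_⟩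
  have := hF.bound (Fin.snoc (α := fun _ => ℝ) x y)
  rw [Fin.sum_univ_castSucc] at this
  simp only [Fin.snoc_castSucc, Fin.snoc_last] at this
  linarith

/-- The slope `B` is preserved and `A` grows by an amount independent of `a`, so the bounds stay
uniform in the parameters at all levels. -/
lemma parisiStep {F : (Fin (k + 1) → ℝ) → ℝ} (hF : LinearGrowth A B F) {a : ℝ} (ha0 : 0 ≤ a)
    (ha1 : a ≤ 1) :
    LinearGrowth (A + growthConst B) B fun x =>
      _root_.parisiStep a fun y => F (Fin.snoc (α := fun _ => ℝ) x y) where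
  measurable := by
    have hm : Measurable fun p : (Fin k → ℝ) × ℝ => F (Fin.snoc (α := fun _ => ℝ) p.1 p.2) :=
      hF.measurable.comp measurable_snoc
    unfold _root_.parisiStep
    split_ifs
    · exact (hm.stronglyMeasurable.integral_prod_right).measurable
    · have hm2 : Measurable fun p : (Fin k → ℝ) × ℝ =>
          Real.exp (a * F (Fin.snoc (α := fun _ => ℝ) p.1 p.2)) := (hm.const_mul a).exp
      exact ((hm2.stronglyMeasurable.integral_prod_right).measurable.log).const_mul _
  nonneg := hF.nonneg
  bound x := by
    have h := hF.comp_snoc x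
    have := abs_parisiStep_le hF.nonneg h.1 h.2 ha0 ha1
    linarith

end LinearGrowth

/-- The function has to vary with `n` for the induction, because after one step it depends on the
parameters. -/
lemma tendsto_parisiRecursion {m : ℕ → ℝ} {ms : ℕ → ℕ → ℝ} :
    ∀ {k : ℕ}, (∀ i, 1 ≤ i → i ≤ k → ∀ n, 0 < ms n i ∧ ms n i ≤ 1) →
      (∀ i, 1 ≤ i → i ≤ k → Tendsto (fun n => ms n i) atTop (𝓝 (m i))) →
      ∀ {A B : ℝ} {Fs : ℕ → (Fin k → ℝ) → ℝ} {F : (Fin k → ℝ) → ℝ},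
      (∀ n, LinearGrowth A B (Fs n)) → (∀ x, Tendsto (fun n => Fs n x) atTop (𝓝 (F x))) →
      Tendsto (fun n => parisiRecursion (ms n) k (Fs n)) atTop (𝓝 (parisiRecursion m k F)) := by
  intro k
  induction k with
  | zero => exact fun _ _ {A B Fs F} _ h => h _
  | succ k ih =>
    intro hms hlim A B Fs F hFs hF
    refine ih (fun i h1 h2 => hms i h1 (h2.trans k.le_succ))
      (fun i h1 h2 => hlim i h1 (h2.trans k.le_succ)) (A := A + growthConst B) (B := B)
      (fun n => (hFs n).parisiStep (hms (k + 1) (by omega) le_rfl n).1.le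
        (hms (k + 1) (by omega) le_rfl n).2) fun x => ?_
    exact tendsto_parisiStep (fun n => ((hFs n).comp_snoc x).1) (fun n => ((hFs n).comp_snoc x).2)
      (fun y => hF _) (fun n => (hms (k + 1) (by omega) le_rfl n).1)
      (fun n => (hms (k + 1) (by omega) le_rfl n).2) (hlim (k + 1) (by omega) le_rfl)

/-! ### Vertices of the tree -/

section Tree

variable {k : ℕ}

lemma length_ancestor (α : Fin k → ℕ) {l : ℕ} (hl : l ≤ k) : (ancestor α l).length = l := by
  simp [ancestor, hl]

lemma ofFn_snoc (α : Fin k → ℕ) (n : ℕ) :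
    List.ofFn (Fin.snoc (α := fun _ => ℕ) α n : Fin (k + 1) → ℕ) = List.ofFn α ++ [n] := by
  rw [List.ofFn_succ']
  simp

lemma ancestor_snoc (α : Fin k → ℕ) (n : ℕ) {l : ℕ} (hl : l ≤ k) :
    ancestor (Fin.snoc (α := fun _ => ℕ) α n : Fin (k + 1) → ℕ) l = ancestor α l := by
  rw [ancestor, ofFn_snoc, ancestor, List.take_append_of_le_length (by simpa using hl)]

lemma ancestor_snoc_last (α : Fin k → ℕ) (n : ℕ) :
    ancestor (Fin.snoc (α := fun _ => ℕ) α n : Fin (k + 1) → ℕ) (k + 1) = List.ofFn α ++ [n] := by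
  rw [ancestor, ofFn_snoc, List.take_of_length_le (by simp)]

lemma pathSum_snoc (x : List ℕ → ℝ) (α : Fin k → ℕ) (n : ℕ) :
    pathSum x (Fin.snoc (α := fun _ => ℕ) α n : Fin (k + 1) → ℕ)
      = pathSum x α + x (List.ofFn α ++ [n]) := by
  rw [pathSum, Finset.sum_Icc_succ_top (by omega), ancestor_snoc_last, pathSum]
  congr 1
  refine Finset.sum_congr rfl fun l hl => ?_
  rw [ancestor_snoc _ _ (Finset.mem_Icc.1 hl).2]

/-- The values of `g` at the vertices of the path from the root (excluded) to the leaf `α`. -/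
def pathValues (g : List ℕ → ℝ) (α : Fin k → ℕ) : Fin k → ℝ := fun i => g (ancestor α (i + 1))

lemma pathValues_snoc (g : List ℕ → ℝ) (α : Fin k → ℕ) (n : ℕ) :
    pathValues g (Fin.snoc (α := fun _ => ℕ) α n : Fin (k + 1) → ℕ)
      = Fin.snoc (α := fun _ => ℝ) (pathValues g α) (g (List.ofFn α ++ [n])) := by
  funext i
  refine Fin.lastCases ?_ (fun i => ?_) i
  · simp [pathValues, ancestor_snoc_last]
  · simp only [pathValues, Fin.val_castSucc, Fin.snoc_castSucc]
    rw [ancestor_snoc _ _ i.2]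

lemma ofFn_append_injective :
    Function.Injective fun p : (Fin k → ℕ) × ℕ => List.ofFn p.1 ++ [p.2] := by
  rintro ⟨α, n⟩ ⟨α', n'⟩ h
  have h1 := List.append_inj' h rfl
  have h2 := List.ofFn_injective h1.1
  have h3 := h1.2
  simp_all

/-- Leaves at level `k + 1` as pairs of a vertex at level `k` and a natural number. -/
def leafEquiv (k : ℕ) : (Fin k → ℕ) × ℕ ≃ (Fin (k + 1) → ℕ) :=
  (Equiv.prodComm _ _).trans (Fin.snocEquiv fun _ => ℕ)

lemma leafEquiv_apply (p : (Fin k → ℕ) × ℕ) :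
    leafEquiv k p = Fin.snoc (α := fun _ => ℕ) p.1 p.2 := rfl

/-- `∑_α exp (s + a (z_α + F (g along the path to α)))`. -/
def treeSum (x g : List ℕ → ℝ) (F : (Fin k → ℝ) → ℝ) (a s : ℝ) : ℝ≥0∞ :=
  ∑' α : Fin k → ℕ, ENNReal.ofReal (Real.exp (s + a * (pathSum x α + F (pathValues g α))))

end Tree

/-! ### Cascades and Gaussian trees -/

lemma measurable_of_mem_iSup_comap {Ω : Type*} {ι : Type*} {β : ι → Type*} [mβ : ∀ i, MeasurableSpace (β i)]
    {f : ∀ i, Ω → β i} {S : Set ι} {i : ι} (hi : i ∈ S) :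
    Measurable[⨆ i ∈ S, (mβ i).comap (f i)] (f i) :=
  (comap_measurable (f i)).mono (le_iSup₂ (f := fun i _ => (mβ i).comap (f i)) i hi) le_rfl

section Cascade

variable {Ω : Type*} [MeasurableSpace Ω] {P : Measure Ω} {k : ℕ} {m : ℕ → ℝ} {x : List ℕ → Ω → ℝ}

lemma IsCascade.measurable (h : IsCascade P k m x) {γ : List ℕ} (h0 : γ ≠ []) (hk : γ.length ≤ k) :
    Measurable (x γ) := by
  have hl := List.length_pos_of_ne_nil h0
  have := (h.poisson γ.dropLast (by rw [List.length_dropLast]; omega)).measurable (γ.getLast h0)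
  rwa [List.dropLast_append_getLast] at this

lemma IsCascade.of_succ (h : IsCascade P (k + 1) m x) : IsCascade P k m x where
  poisson γ hγ := h.poisson γ (by omega)
  indep := h.indep.precomp
    (g := fun γ : {γ : List ℕ // γ.length < k} => (⟨γ.1, by omega⟩ : {γ : List ℕ // γ.length < k + 1}))
    fun γ γ' hh => by simpa [Subtype.ext_iff] using hh

lemma IsCascade.measurable_pathSum (h : IsCascade P k m x) (α : Fin k → ℕ) :
    Measurable fun ω => pathSum (fun γ => x γ ω) α := by
  refine Finset.measurable_fun_sum _ fun l hl => h.measurable ?_ ?_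
  · rw [Finset.mem_Icc] at hl
    rw [← List.length_pos_iff, length_ancestor α hl.2]
    omega
  · rw [Finset.mem_Icc] at hl
    rw [length_ancestor α hl.2]
    exact hl.2

/-- The process attached to `γ` gives the points of the children of `γ`. Path sums to level `k` thus
involve only vertices of length `< k`, the leaves only those of length `k`. -/
lemma IsCascade.indepFun_last (h : IsCascade P (k + 1) m x) :
    IndepFun (fun ω (α : Fin k → ℕ) => pathSum (fun γ => x γ ω) α)
      (fun ω (α : Fin k → ℕ) (n : ℕ) => x (List.ofFn α ++ [n]) ω) P := by
  have hm : ∀ γ : {γ : List ℕ // γ.length < k + 1}, Measurable fun ω n => x (γ.1 ++ [n]) ω :=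
    fun γ => measurable_pi_lambda _ (h.poisson γ.1 γ.2).measurable
  refine h.indep.indepFun_of_disjoint hm (S := {γ | γ.1.length < k}) (T := {γ | γ.1.length = k})
    ?_ ?_ ?_
  · rw [Set.disjoint_left]
    intro γ h1 h2
    simp only [mem_ofPred_eq] at h1 h2
    omega
  · refine @measurable_pi_lambda _ _ _ (_) _ _ fun α => ?_
    refine @Finset.measurable_fun_sum _ _ _ _ _ _ (_) _ _ fun l hl => ?_
    rw [Finset.mem_Icc] at hl
    set γ := ancestor α l with hγ
    have hlen : γ.length = l := length_ancestor α hl.2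
    have h0 : γ ≠ [] := by rw [← List.length_pos_iff]; omega
    -- The point at `γ` is the coordinate `γ.getLast` of the process attached to its parent
    -- `γ.dropLast`.
    have h2 := measurable_of_mem_iSup_comap
      (f := fun (γ : {γ : List ℕ // γ.length < k + 1}) (ω : Ω) (n : ℕ) => x (γ.1 ++ [n]) ω)
      (S := {γ | γ.1.length < k}) (i := ⟨γ.dropLast, by rw [List.length_dropLast]; omega⟩)
      (by simp only [mem_ofPred_eq, List.length_dropLast]; omega)
    have h3 := (measurable_pi_apply (γ.getLast h0)).comp h2
    simp only [Function.comp_def, List.dropLast_append_getLast] at h3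
    exact h3
  · refine @measurable_pi_lambda _ _ _ (_) _ _ fun α => ?_
    exact measurable_of_mem_iSup_comap
      (f := fun (γ : {γ : List ℕ // γ.length < k + 1}) (ω : Ω) (n : ℕ) => x (γ.1 ++ [n]) ω)
      (S := {γ | γ.1.length = k}) (i := ⟨List.ofFn α, by simp⟩) (by simp)

lemma IsCascade.iIndepFun_last (h : IsCascade P (k + 1) m x) :
    iIndepFun (fun (α : Fin k → ℕ) ω (n : ℕ) => x (List.ofFn α ++ [n]) ω) P :=
  h.indep.precomp
    (g := fun α : Fin k → ℕ => (⟨List.ofFn α, by simp⟩ : {γ : List ℕ // γ.length < k + 1}))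
    fun α α' hh => List.ofFn_injective (by simpa [Subtype.ext_iff] using hh)

/-- The `g γ`, for `γ` a vertex other than the root, are i.i.d. standard Gaussians. -/
structure IsGaussianTree (P : Measure Ω) (k : ℕ) (g : List ℕ → Ω → ℝ) : Prop where
  measurable : ∀ γ : List ℕ, γ ≠ [] → γ.length ≤ k → Measurable (g γ)
  law : ∀ γ : List ℕ, γ ≠ [] → γ.length ≤ k → P.map (g γ) = gaussianReal 0 1
  indep : iIndepFun (fun (γ : {γ : List ℕ // γ ≠ [] ∧ γ.length ≤ k}) (ω : Ω) => g γ.1 ω) P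

variable {g : List ℕ → Ω → ℝ}

lemma IsGaussianTree.of_succ (h : IsGaussianTree P (k + 1) g) : IsGaussianTree P k g where
  measurable γ h0 hγ := h.measurable γ h0 (by omega)
  law γ h0 hγ := h.law γ h0 (by omega)
  indep := h.indep.precomp
    (g := fun γ : {γ : List ℕ // γ ≠ [] ∧ γ.length ≤ k} =>
      (⟨γ.1, γ.2.1, by omega⟩ : {γ : List ℕ // γ ≠ [] ∧ γ.length ≤ k + 1}))
    fun γ γ' hh => by simpa [Subtype.ext_iff] using hh

lemma ancestor_succ_ne_nil (α : Fin k → ℕ) (i : Fin k) : ancestor α (i + 1) ≠ [] := by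
  rw [← List.length_pos_iff, length_ancestor α i.2]
  omega

lemma IsGaussianTree.measurable_pathValues (h : IsGaussianTree P k g) (α : Fin k → ℕ) :
    Measurable fun ω => pathValues (fun γ => g γ ω) α :=
  measurable_pi_lambda _ fun i =>
    h.measurable _ (ancestor_succ_ne_nil α i) (by rw [length_ancestor α i.2]; exact i.2)

lemma IsGaussianTree.indepFun_last (h : IsGaussianTree P (k + 1) g) :
    IndepFun (fun ω (α : Fin k → ℕ) => pathValues (fun γ => g γ ω) α)
      (fun ω (p : (Fin k → ℕ) × ℕ) => g (List.ofFn p.1 ++ [p.2]) ω) P := by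
  refine h.indep.indepFun_of_disjoint (fun γ => h.measurable γ.1 γ.2.1 γ.2.2)
    (S := {γ | γ.1.length < k + 1}) (T := {γ | γ.1.length = k + 1}) ?_ ?_ ?_
  · rw [Set.disjoint_left]
    intro γ h1 h2
    simp only [mem_ofPred_eq] at h1 h2
    omega
  · refine @measurable_pi_lambda _ _ _ (_) _ _ fun α => @measurable_pi_lambda _ _ _ (_) _ _ fun i => ?_
    have hl := length_ancestor α (Nat.succ_le_of_lt i.2)
    have hi := i.2
    rw [Nat.succ_eq_add_one] at hl
    exact measurable_of_mem_iSup_comap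
      (f := fun (γ : {γ : List ℕ // γ ≠ [] ∧ γ.length ≤ k + 1}) (ω : Ω) => g γ.1 ω)
      (S := {γ | γ.1.length < k + 1}) (i := ⟨ancestor α (i + 1), ancestor_succ_ne_nil α i, by omega⟩)
      (by simp only [mem_ofPred_eq]; omega)
  · refine @measurable_pi_lambda _ _ _ (_) _ _ fun p => ?_
    exact measurable_of_mem_iSup_comap
      (f := fun (γ : {γ : List ℕ // γ ≠ [] ∧ γ.length ≤ k + 1}) (ω : Ω) => g γ.1 ω)
      (S := {γ | γ.1.length = k + 1}) (i := ⟨List.ofFn p.1 ++ [p.2], by simp, by simp⟩) (by simp)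

lemma IsGaussianTree.iIndepFun_last (h : IsGaussianTree P (k + 1) g) :
    iIndepFun (fun (p : (Fin k → ℕ) × ℕ) ω => g (List.ofFn p.1 ++ [p.2]) ω) P :=
  h.indep.precomp
    (g := fun p : (Fin k → ℕ) × ℕ => (⟨List.ofFn p.1 ++ [p.2], by simp, by simp⟩ :
      {γ : List ℕ // γ ≠ [] ∧ γ.length ≤ k + 1}))
    fun p p' hh => ofFn_append_injective (by simpa only [Subtype.mk.injEq] using hh)

end Cascade

/-! ### The Laplace transform of the partition function -/

section Laplace

variable {k : ℕ} {F : (Fin (k + 1) → ℝ) → ℝ}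

/-- The exponent obtained by averaging over the Gaussian variable at a leaf. -/
def leafExponent (F : (Fin (k + 1) → ℝ) → ℝ) (a s z : ℝ) (y : Fin k → ℝ) (u : ℝ) : ℝ≥0∞ :=
  negLog (∫⁻ w, expNeg (ENNReal.ofReal (Real.exp
    (s + a * (z + u + F (Fin.snoc (α := fun _ => ℝ) y w))))) ∂(gaussianReal 0 1))

lemma expNeg_leafExponent (F : (Fin (k + 1) → ℝ) → ℝ) (a s z : ℝ) (y : Fin k → ℝ) (u : ℝ) :
    expNeg (leafExponent F a s z y u) = ∫⁻ w, expNeg (ENNReal.ofReal (Real.exp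
      (s + a * (z + u + F (Fin.snoc (α := fun _ => ℝ) y w))))) ∂(gaussianReal 0 1) := by
  refine expNeg_negLog ?_
  calc _ ≤ ∫⁻ w, 1 ∂(gaussianReal 0 1) := lintegral_mono fun w => expNeg_le_one _
    _ = 1 := by simp

lemma measurable_leafExponent (hF : Measurable F) (a s : ℝ) :
    Measurable fun p : ℝ × (Fin k → ℝ) × ℝ => leafExponent F a s p.1 p.2.1 p.2.2 := by
  refine measurable_negLog.comp (Measurable.lintegral_prod_right' (f := fun q :
    (ℝ × (Fin k → ℝ) × ℝ) × ℝ => expNeg (ENNReal.ofReal (Real.exp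
      (s + a * (q.1.1 + q.1.2.2 + F (Fin.snoc (α := fun _ => ℝ) q.1.2.1 q.2)))))) ?_)
  have : Measurable fun q : (ℝ × (Fin k → ℝ) × ℝ) × ℝ =>
      F (Fin.snoc (α := fun _ => ℝ) q.1.2.1 q.2) :=
    hF.comp (measurable_snoc.comp (by fun_prop : Measurable fun q : (ℝ × (Fin k → ℝ) × ℝ) × ℝ =>
      (q.1.2.1, q.2)))
  fun_prop

lemma Measurable.leafExponent {β : Type*} [MeasurableSpace β] (hF : Measurable F) (a s : ℝ)
    {z u : β → ℝ} {y : β → Fin k → ℝ} (hz : Measurable z) (hy : Measurable y) (hu : Measurable u) :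
    Measurable fun q => leafExponent F a s (z q) (y q) (u q) := by
  have h := (measurable_leafExponent hF a s).comp (hz.prodMk (hy.prodMk hu))
  exact h

/-- The core of the recursion. After Tonelli, the shift rule for each value `w` of the Gaussian
turns `e^{a f w}` into `e^{b f w}`, and the Gaussian mean of the latter is the exponential of `b`
times `parisiStep b f`. -/
lemma lintegral_one_sub_leafExponent {A B a b : ℝ} (hF : LinearGrowth A B F) (hb : 0 < b)
    (ha : 0 < a) (s z : ℝ) (y : Fin k → ℝ) :
    ∫⁻ u, (1 - expNeg (leafExponent F a s z y u)) ∂(expIntensity b)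
      = ENNReal.ofReal b * upperConst a b * ENNReal.ofReal (Real.exp (b / a * s
        + b * (z + parisiStep b fun w => F (Fin.snoc (α := fun _ => ℝ) y w)))) := by
  obtain ⟨hm, hbd⟩ := hF.comp_snoc y
  set f := fun w => F (Fin.snoc (α := fun _ => ℝ) y w) with hf
  have h1 : ∀ u, 1 - expNeg (leafExponent F a s z y u) = ∫⁻ w, (1 - expNeg (ENNReal.ofReal
      (Real.exp ((s + a * z + a * f w) + a * u)))) ∂(gaussianReal 0 1) := by
    intro u
    rw [lintegral_sub (by fun_prop) _ (Eventually.of_forall fun w => expNeg_le_one _),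
      expNeg_leafExponent]
    · simp only [lintegral_const, measure_univ, mul_one]
      congr 1
      refine lintegral_congr fun w => ?_
      congr 3
      simp only [hf]
      ring
    · exact ((lintegral_mono fun w => expNeg_le_one _).trans_lt (by simp)).ne
  simp_rw [h1]
  rw [lintegral_lintegral_swap (by fun_prop)]
  simp_rw [lintegral_expIntensity_one_sub_expNeg hb ha.ne']
  have h2 : ∀ w, ENNReal.ofReal (Real.exp (b / a * (s + a * z + a * f w)))
      = ENNReal.ofReal (Real.exp (b / a * s + b * z)) * ENNReal.ofReal (Real.exp (b * f w)) := by
    intro w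
    rw [← ENNReal.ofReal_mul (Real.exp_pos _).le, ← Real.exp_add]
    congr 2
    field_simp
  simp_rw [h2]
  rw [lintegral_const_mul _ (by fun_prop), lintegral_const_mul _ (by fun_prop),
    ← ofReal_integral_eq_lintegral_ofReal (integrable_exp_mul_of_growth hm hbd b)
      (Eventually.of_forall fun w => (Real.exp_pos _).le),
    ← exp_mul_parisiStep hm hbd hb.ne', ← ENNReal.ofReal_mul (Real.exp_pos _).le, ← Real.exp_add]
  congr 3
  rw [mul_add, add_assoc]

/-- A term of the partition function, as a function of the variables at the leaf. -/
def leafTerm (F : (Fin (k + 1) → ℝ) → ℝ) (a s z u : ℝ) (y : Fin k → ℝ) (w : ℝ) : ℝ≥0∞ :=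
  ENNReal.ofReal (Real.exp (s + a * (z + u + F (Fin.snoc (α := fun _ => ℝ) y w))))

lemma Measurable.leafTerm {β : Type*} [MeasurableSpace β] (hF : Measurable F) (a s z u : ℝ)
    {y : β → Fin k → ℝ} {w : β → ℝ} (hy : Measurable y) (hw : Measurable w) :
    Measurable fun q => leafTerm F a s z u (y q) (w q) := by
  unfold _root_.leafTerm
  have := hF.comp (measurable_snoc.comp (hy.prodMk hw))
  simp only [Function.comp_def] at this
  fun_prop

lemma treeSum_succ (x g : List ℕ → ℝ) (a s : ℝ) :
    treeSum x g F a s = ∑' p : (Fin k → ℕ) × ℕ, leafTerm F a s (pathSum x p.1)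
      (x (List.ofFn p.1 ++ [p.2])) (pathValues g p.1) (g (List.ofFn p.1 ++ [p.2])) := by
  rw [treeSum, ← (leafEquiv k).tsum_eq]
  simp_rw [leafEquiv_apply, pathSum_snoc, pathValues_snoc, leafTerm]

lemma IsGaussianTree.lintegral_expNeg_leafTerm {Ω' : Type*} [MeasurableSpace Ω'] {Q : Measure Ω'}
    {g : List ℕ → Ω' → ℝ} {l : ℕ} (hg : IsGaussianTree Q l g)
    (hF : Measurable F) (a s z u : ℝ) (y : Fin k → ℝ) {γ : List ℕ} (h0 : γ ≠ [])
    (hl : γ.length ≤ l) :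
    ∫⁻ ω, expNeg (leafTerm F a s z u y (g γ ω)) ∂Q = expNeg (leafExponent F a s z y u) := by
  have h : Measurable fun w => expNeg (leafTerm F a s z u y w) :=
    measurable_expNeg.comp (Measurable.leafTerm hF a s z u measurable_const measurable_id)
  rw [expNeg_leafExponent, ← hg.law γ h0 hl, ← lintegral_map h (hg.measurable γ h0 hl)]
  rfl

variable {Ω Ω' : Type*} [MeasurableSpace Ω] [MeasurableSpace Ω'] {P : Measure Ω} {Q : Measure Ω'}
  [IsProbabilityMeasure P] [IsProbabilityMeasure Q] {m : ℕ → ℝ} {x : List ℕ → Ω → ℝ}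
  {g : List ℕ → Ω' → ℝ}

/-- With the points frozen, the Gaussians at the leaves are independent of one another and of those
above, so each leaf is averaged separately. -/
lemma IsGaussianTree.lintegral_leaves (hg : IsGaussianTree Q (k + 1) g) (hF : Measurable F)
    (a s : ℝ) (x : List ℕ → ℝ) :
    ∫⁻ ω, expNeg (treeSum x (fun γ => g γ ω) F a s) ∂Q
      = ∫⁻ ω, expNeg (∑' (α : Fin k → ℕ), ∑' n, leafExponent F a s (pathSum x α)
        (pathValues (fun γ => g γ ω) α) (x (List.ofFn α ++ [n]))) ∂Q := by
  have hgm : ∀ p : (Fin k → ℕ) × ℕ, Measurable (g (List.ofFn p.1 ++ [p.2])) := fun p =>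
    hg.measurable _ (by simp) (by simp)
  have h1 : ∀ p : (Fin k → ℕ) × ℕ, Measurable (Function.uncurry
      fun (Y : (Fin k → ℕ) → Fin k → ℝ) w =>
        leafTerm F a s (pathSum x p.1) (x (List.ofFn p.1 ++ [p.2])) (Y p.1) w) := fun p =>
    Measurable.leafTerm hF a s _ _ ((measurable_pi_apply p.1).comp measurable_fst) measurable_snd
  have h2 : ∀ (p : (Fin k → ℕ) × ℕ) (Y : (Fin k → ℕ) → Fin k → ℝ),
      ∫⁻ ω, expNeg (leafTerm F a s (pathSum x p.1) (x (List.ofFn p.1 ++ [p.2])) (Y p.1)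
        (g (List.ofFn p.1 ++ [p.2]) ω)) ∂Q
      = expNeg (leafExponent F a s (pathSum x p.1) (Y p.1) (x (List.ofFn p.1 ++ [p.2]))) :=
    fun p Y => hg.lintegral_expNeg_leafTerm hF a s _ _ _ (by simp) (by simp)
  have key := lintegral_expNeg_tsum_of_indepFun hg.indepFun_last hg.iIndepFun_last
    (measurable_pi_lambda _ fun α => hg.of_succ.measurable_pathValues α) hgm h1
    (c := fun p Y => leafExponent F a s (pathSum x p.1) (Y p.1) (x (List.ofFn p.1 ++ [p.2]))) h2
  simp_rw [treeSum_succ]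
  rw [key]
  refine lintegral_congr fun ω => ?_
  rw [ENNReal.tsum_prod']

/-- With the Gaussians frozen, each vertex `α` of level `k` contributes through the Laplace
functional of its own process. The outcome is again a `treeSum`, one level shorter. -/
lemma IsCascade.lintegral_leaves (hx : IsCascade P (k + 1) m x) {A B a : ℝ}
    (hF : LinearGrowth A B F) (hb : 0 < m (k + 1)) (ha : 0 < a) {D : ℝ}
    (hD : ENNReal.ofReal (m (k + 1)) * upperConst a (m (k + 1)) = ENNReal.ofReal (Real.exp D))
    (s : ℝ) (g : List ℕ → ℝ) :
    ∫⁻ ω, expNeg (∑' (α : Fin k → ℕ), ∑' n, leafExponent F a s (pathSum (fun γ => x γ ω) α)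
        (pathValues g α) (x (List.ofFn α ++ [n]) ω)) ∂P
      = ∫⁻ ω, expNeg (treeSum (fun γ => x γ ω) g
        (fun y : Fin k → ℝ => parisiStep (m (k + 1)) fun w => F (Fin.snoc (α := fun _ => ℝ) y w))
          (m (k + 1)) (D + m (k + 1) / a * s)) ∂P := by
  have h1 : ∀ α : Fin k → ℕ, Measurable (Function.uncurry fun (Z : (Fin k → ℕ) → ℝ) (v : ℕ → ℝ) =>
      ∑' n, leafExponent F a s (Z α) (pathValues g α) (v n)) := fun α =>
    Measurable.tsum fun n => Measurable.leafExponent hF.measurable a s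
      ((measurable_pi_apply α).comp measurable_fst) measurable_const
      ((measurable_pi_apply n).comp measurable_snd)
  have h2 : ∀ (α : Fin k → ℕ) (Z : (Fin k → ℕ) → ℝ),
      ∫⁻ ω, expNeg (∑' n, leafExponent F a s (Z α) (pathValues g α) (x (List.ofFn α ++ [n]) ω)) ∂P
      = expNeg (ENNReal.ofReal (Real.exp (D + m (k + 1) / a * s + m (k + 1) * (Z α +
        parisiStep (m (k + 1)) fun w => F (Fin.snoc (α := fun _ => ℝ) (pathValues g α) w))))) := by
    intro α Z
    have hp := hx.poisson (List.ofFn α) (by simp)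
    rw [List.length_ofFn] at hp
    have hle : Measurable fun u => leafExponent F a s (Z α) (pathValues g α) u :=
      Measurable.leafExponent hF.measurable a s measurable_const measurable_const measurable_id
    rw [hp.lintegral_expNeg hle, lintegral_one_sub_leafExponent hF hb ha, hD,
      ← ENNReal.ofReal_mul (Real.exp_pos _).le, ← Real.exp_add, add_assoc]
  exact lintegral_expNeg_tsum_of_indepFun hx.indepFun_last hx.iIndepFun_last
    (measurable_pi_lambda _ fun α => hx.of_succ.measurable_pathSum α)
    (fun α => measurable_pi_lambda _ fun n => hx.measurable (by simp) (by simp)) h1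
    (c := fun α Z => ENNReal.ofReal (Real.exp (D + m (k + 1) / a * s + m (k + 1) * (Z α +
      parisiStep (m (k + 1)) fun w => F (Fin.snoc (α := fun _ => ℝ) (pathValues g α) w))))) h2

end Laplace

section Laplace

variable {Ω Ω' : Type*} [MeasurableSpace Ω] [MeasurableSpace Ω'] {P : Measure Ω} {Q : Measure Ω'}
  {m : ℕ → ℝ} {x : List ℕ → Ω → ℝ} {g : List ℕ → Ω' → ℝ}

lemma measurable_treeSum {k : ℕ} (hx : IsCascade P k m x) (hg : IsGaussianTree Q k g)
    {F : (Fin k → ℝ) → ℝ} (hF : Measurable F) (a s : ℝ) :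
    Measurable fun p : Ω × Ω' => treeSum (fun γ => x γ p.1) (fun γ => g γ p.2) F a s := by
  unfold treeSum
  refine Measurable.tsum fun α => ?_
  have h1 := (hx.measurable_pathSum α).comp (measurable_fst : Measurable (Prod.fst : Ω × Ω' → Ω))
  have h2 := hF.comp ((hg.measurable_pathValues α).comp
    (measurable_snd : Measurable (Prod.snd : Ω × Ω' → Ω')))
  exact ((((h1.add h2).const_mul a).const_add s).exp).ennreal_ofReal

/-- The Laplace transform of the partition function of a cascade. -/
theorem exists_lintegral_expNeg_treeSum [IsProbabilityMeasure P] [IsProbabilityMeasure Q]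
    (hm1 : 0 < m 1) :
    ∀ {k : ℕ}, (∀ i, 1 ≤ i → i ≤ k → m i < m (i + 1)) → IsCascade P k m x →
      IsGaussianTree Q k g → ∃ D : ℝ, ∀ {A B : ℝ} {F : (Fin k → ℝ) → ℝ}, LinearGrowth A B F →
      m (k + 1) ≤ 1 → ∀ s, ∫⁻ ω, ∫⁻ ω', expNeg (treeSum (fun γ => x γ ω) (fun γ => g γ ω') F
          (m (k + 1)) s) ∂Q ∂P
        = expNeg (ENNReal.ofReal (Real.exp
          (D + m 1 / m (k + 1) * s + m 1 * parisiRecursion m k F))) := by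
  intro k
  induction k with
  | zero =>
    intro _ _ _
    refine ⟨0, fun {A B F} _ _ s => ?_⟩
    have h1 : ∀ ω ω', treeSum (k := 0) (fun γ => x γ ω) (fun γ => g γ ω') F (m (0 + 1)) s
        = ENNReal.ofReal (Real.exp (0 + m 1 / m (0 + 1) * s + m 1 * parisiRecursion m 0 F)) := by
      intro ω ω'
      rw [treeSum, tsum_fintype, Fintype.sum_unique]
      simp only [pathSum, parisiRecursion, zero_add, div_self hm1.ne', one_mul]
      congr 3
      simp only [show Finset.Icc 1 0 = ∅ from rfl, Finset.sum_empty, zero_add]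
      congr 2
      exact Subsingleton.elim _ _
    simp_rw [h1]
    simp
  | succ k ih =>
    intro hm hx hg
    have hpos : ∀ i, 1 ≤ i → i ≤ k + 2 → 0 < m i := by
      intro i h1 h2
      induction i, h1 using Nat.le_induction with
      | base => exact hm1
      | succ i h1 ih => exact (ih (by omega)).trans (hm i h1 (by omega))
    set b := m (k + 1) with hbdef
    set a := m (k + 1 + 1) with hadef
    have hb : 0 < b := hpos (k + 1) (by omega) (by omega)
    have ha : 0 < a := hpos (k + 1 + 1) (by omega) (by omega)
    have hba : b < a := hm (k + 1) (by omega) le_rfl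
    -- `D` is fixed before `F` appears; this is why it later cancels between two choices of `F`.
    obtain ⟨D, hD⟩ := ih (fun i h1 h2 => hm i h1 (by omega)) hx.of_succ hg.of_succ
    obtain ⟨D', hD'⟩ : ∃ D' : ℝ, ENNReal.ofReal b * upperConst a b
        = ENNReal.ofReal (Real.exp D') := by
      set c := ENNReal.ofReal b * upperConst a b with hc
      have hc0 : c ≠ 0 := mul_ne_zero (ENNReal.ofReal_pos.2 hb).ne' (upperConst_ne_zero a b)
      have hct : c ≠ ∞ := ENNReal.mul_ne_top ENNReal.ofReal_ne_top (upperConst_ne_top hb hba)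
      exact ⟨Real.log c.toReal, by
        rw [Real.exp_log (ENNReal.toReal_pos hc0 hct), ENNReal.ofReal_toReal hct]⟩
    -- `D'` enters the shorter sum through its parameter `s`, hence the factor `m 1 / b`.
    refine ⟨D + m 1 / b * D', fun {A B F} hF ha1 s => ?_⟩
    have hF' := hF.parisiStep hb.le (hba.le.trans ha1)
    have hts := measurable_treeSum hx.of_succ hg.of_succ hF'.measurable b (D' + b / a * s)
    -- The leaf Gaussians are averaged with `x` frozen and the leaf points with `g` frozen, so the
    -- order of integration is swapped before and after the second average.
    calc _ = ∫⁻ ω, ∫⁻ ω', expNeg (∑' (α : Fin k → ℕ), ∑' n, leafExponent F a s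
          (pathSum (fun γ => x γ ω) α) (pathValues (fun γ => g γ ω') α)
          (x (List.ofFn α ++ [n]) ω)) ∂Q ∂P :=
          lintegral_congr fun ω => hg.lintegral_leaves hF.measurable a s fun γ => x γ ω
      _ = ∫⁻ ω', ∫⁻ ω, expNeg (∑' (α : Fin k → ℕ), ∑' n, leafExponent F a s
          (pathSum (fun γ => x γ ω) α) (pathValues (fun γ => g γ ω') α)
          (x (List.ofFn α ++ [n]) ω)) ∂P ∂Q := by
          refine lintegral_lintegral_swap (Measurable.aemeasurable ?_)
          refine measurable_expNeg.comp (Measurable.tsum fun α => Measurable.tsum fun n => ?_)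
          have hxm : Measurable (x (List.ofFn α ++ [n])) := hx.measurable (by simp) (by simp)
          exact Measurable.leafExponent hF.measurable a s
            ((hx.of_succ.measurable_pathSum α).comp measurable_fst)
            ((hg.of_succ.measurable_pathValues α).comp measurable_snd) (hxm.comp measurable_fst)
      _ = ∫⁻ ω', ∫⁻ ω, expNeg (treeSum (fun γ => x γ ω) (fun γ => g γ ω')
            (fun y : Fin k → ℝ => parisiStep b fun w => F (Fin.snoc (α := fun _ => ℝ) y w))
            b (D' + b / a * s)) ∂P ∂Q :=
          lintegral_congr fun ω' => hx.lintegral_leaves hF hb ha hD' s _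
      _ = ∫⁻ ω, ∫⁻ ω', expNeg (treeSum (fun γ => x γ ω) (fun γ => g γ ω')
            (fun y : Fin k → ℝ => parisiStep b fun w => F (Fin.snoc (α := fun _ => ℝ) y w))
            b (D' + b / a * s)) ∂Q ∂P := by
          refine lintegral_lintegral_swap (Measurable.aemeasurable ?_)
          have h5 := measurable_expNeg.comp
            (hts.comp (measurable_swap : Measurable (Prod.swap : Ω' × Ω → Ω × Ω')))
          exact h5
      _ = _ := by
          rw [hD hF' (hba.le.trans ha1)]
          congr 3
          have : m 1 / b * (b / a * s) = m 1 / a * s := by field_simp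
          rw [mul_add, this, parisiRecursion]
          ring

end Laplace

/-! ### Logarithmic moments of stable variables -/

section Stable

variable {Ω : Type*} [MeasurableSpace Ω] {μ : Measure Ω} {b : ℝ}

/-- As `s → -∞` the transform tends to the probability that `T` is finite, and the right side tends
to `1`. -/
lemma ae_ne_top_of_stable [IsProbabilityMeasure μ] {T : Ω → ℝ≥0∞} (hT : Measurable T) {K : ℝ} (hb : 0 < b)
    (hL : ∀ s, ∫⁻ ω, expNeg (ENNReal.ofReal (Real.exp s) * T ω) ∂μ
      = expNeg (ENNReal.ofReal (Real.exp (K + b * s)))) : ∀ᵐ ω ∂μ, T ω ≠ ∞ := by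
  have hs : MeasurableSet {ω | T ω ≠ ∞} := (hT (measurableSet_singleton ∞)).compl
  have hexp : ∀ n : ℕ, Real.exp (-(n : ℝ)) = Real.exp (-1) ^ n := fun n => by
    rw [← Real.exp_nat_mul]; congr 1; ring
  have h0 : Tendsto (fun n : ℕ => -(n : ℝ)) atTop atBot :=
    tendsto_neg_atTop_atBot.comp tendsto_natCast_atTop_atTop
  have h1 : Tendsto (fun n : ℕ => ∫⁻ ω, expNeg (ENNReal.ofReal (Real.exp (-(n : ℝ))) * T ω) ∂μ) atTop
      (𝓝 (∫⁻ ω, {ω | T ω ≠ ∞}.indicator 1 ω ∂μ)) := by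
    refine tendsto_lintegral_of_dominated_convergence (fun _ => 1) (fun n => by fun_prop)
      (fun n => Eventually.of_forall fun ω => expNeg_le_one _) (by simp)
      (Eventually.of_forall fun ω => ?_)
    by_cases hω : T ω = ∞
    · have : ∀ n : ℕ, ENNReal.ofReal (Real.exp (-(n : ℝ))) * T ω = ∞ := fun n => by
        rw [hω, ENNReal.mul_top (ENNReal.ofReal_pos.2 (Real.exp_pos _)).ne']
      simp_rw [this]
      simp [hω]
    · rw [Set.indicator_of_mem (by exact hω), Pi.one_apply, ← expNeg_zero]
      refine (continuous_expNeg.tendsto _).comp ?_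
      have h2 := ENNReal.tendsto_ofReal (Real.tendsto_exp_atBot.comp h0)
      have h3 := ENNReal.Tendsto.mul_const h2 (Or.inr hω)
      simpa using h3
  have h2 : Tendsto (fun n : ℕ => expNeg (ENNReal.ofReal (Real.exp (K + b * (-(n : ℝ)))))) atTop
      (𝓝 1) := by
    rw [← expNeg_zero]
    refine (continuous_expNeg.tendsto _).comp ?_
    rw [← ENNReal.ofReal_zero]
    refine ENNReal.tendsto_ofReal (Real.tendsto_exp_atBot.comp ?_)
    exact tendsto_atBot_add_const_left _ _ (h0.const_mul_atBot hb)
  simp_rw [hL] at h1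
  have h3 := tendsto_nhds_unique h1 h2
  rw [lintegral_indicator_one hs] at h3
  exact (prob_compl_eq_zero_iff hs).2 h3


lemma integrable_of_mul_lintegral_eq {f : Ω → ℝ} (hf : Measurable f) {c d : ℝ≥0∞} (hc : c ≠ 0)
    (hd : d ≠ ∞) (h : c * ∫⁻ ω, ENNReal.ofReal (f ω) ∂μ = d) (hf0 : ∀ ω, 0 ≤ f ω) :
    Integrable f μ := by
  refine (lintegral_ofReal_ne_top_iff_integrable hf.aestronglyMeasurable
    (Eventually.of_forall hf0)).1 fun h0 => hd ?_
  rw [← h, h0, ENNReal.mul_top hc]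

lemma integral_eq_mul_of_mul_lintegral_eq {f : Ω → ℝ} (hf : Measurable f) {c d : ℝ≥0∞}
    {e : ℝ} (hc : c ≠ 0) (hc' : c ≠ ∞) (he : 0 ≤ e)
    (h : c * ∫⁻ ω, ENNReal.ofReal (f ω) ∂μ = d * ENNReal.ofReal e) (hf0 : ∀ ω, 0 ≤ f ω) :
    ∫ ω, f ω ∂μ = d.toReal / c.toReal * e := by
  rw [integral_eq_lintegral_of_nonneg_ae (Eventually.of_forall hf0) hf.aestronglyMeasurable]
  have h1 := congrArg ENNReal.toReal h
  rw [ENNReal.toReal_mul, ENNReal.toReal_mul, ENNReal.toReal_ofReal he] at h1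
  have h2 := (ENNReal.toReal_pos hc hc').ne'
  field_simp
  linarith

/-- The logarithm of a variable whose Laplace transform is that of a stable law has exponential
moments, which depend on the scale parameter in the expected way. -/
lemma exists_mgf_of_stable [IsProbabilityMeasure μ] (hb : 0 < b) (hb1 : b ≤ 1) : ∃ C : ℝ → ℝ, ∀ {Y : Ω → ℝ} {K : ℝ},
    Measurable Y → (∀ s, ∫⁻ ω, expNeg (ENNReal.ofReal (Real.exp (s + Y ω))) ∂μ
      = expNeg (ENNReal.ofReal (Real.exp (K + b * s)))) →
    ∀ c, -b < c → c < b →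
      Integrable (fun ω => Real.exp (c * Y ω)) μ ∧ mgf Y μ c = C c * Real.exp (c / b * K) := by
  -- The factor `C` is chosen before `Y` and `K`: it depends only on `b` and `c`.
  refine ⟨fun c => if 0 < c then (upperConst b c).toReal / (upperConst 1 c).toReal else
    if c < 0 then (lowerConst b (-c)).toReal / (lowerConst 1 (-c)).toReal else 1,
    fun {Y K} hY hL c hc1 hc2 => ?_⟩
  have hm : Measurable fun ω => Real.exp (c * Y ω) := by fun_prop
  rcases lt_trichotomy c 0 with hc | rfl | hc
  · have h := lintegral_exp_neg_mul_of_stable hY hb hL (c := -c)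
    rw [neg_neg] at h
    have hd := lowerConst_ne_top (b := b) (m := -c) (by linarith) (by linarith)
    have hc' := lowerConst_ne_top (b := 1) (m := -c) (by linarith) (by linarith)
    refine ⟨integrable_of_mul_lintegral_eq hm (lowerConst_ne_zero 1 (-c))
      (ENNReal.mul_ne_top hd ENNReal.ofReal_ne_top) h fun ω => (Real.exp_pos _).le, ?_⟩
    simp only [not_lt.2 hc.le, hc, if_true, if_false]
    exact integral_eq_mul_of_mul_lintegral_eq hm (lowerConst_ne_zero 1 (-c)) hc'
      (Real.exp_pos _).le h fun ω => (Real.exp_pos _).le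
  · simp
  · have h := lintegral_exp_mul_of_stable hY hb hL measure_univ (c := c)
    have hd := upperConst_ne_top (b := b) (m := c) hc hc2
    have hc' := upperConst_ne_top (b := 1) (m := c) hc (by linarith)
    refine ⟨integrable_of_mul_lintegral_eq hm (upperConst_ne_zero 1 c)
      (ENNReal.mul_ne_top hd ENNReal.ofReal_ne_top) h fun ω => (Real.exp_pos _).le, ?_⟩
    simp only [hc, if_true]
    exact integral_eq_mul_of_mul_lintegral_eq hm (upperConst_ne_zero 1 c) hc'
      (Real.exp_pos _).le h fun ω => (Real.exp_pos _).le

/-- Near `0` one generating function is the other times `e^{c (K - K') / b}`. Differentiating at `c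
= 0` gives the difference of means without evaluating the common factor `C`. -/
lemma integral_log_of_stable [IsProbabilityMeasure μ] (hb : 0 < b) (hb1 : b ≤ 1) {Y Y' : Ω → ℝ} {K K' : ℝ}
    (hY : Measurable Y) (hY' : Measurable Y')
    (hL : ∀ s, ∫⁻ ω, expNeg (ENNReal.ofReal (Real.exp (s + Y ω))) ∂μ
      = expNeg (ENNReal.ofReal (Real.exp (K + b * s))))
    (hL' : ∀ s, ∫⁻ ω, expNeg (ENNReal.ofReal (Real.exp (s + Y' ω))) ∂μ
      = expNeg (ENNReal.ofReal (Real.exp (K' + b * s)))) :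
    Integrable Y μ ∧ Integrable Y' μ ∧ ∫ ω, Y ω ∂μ - ∫ ω, Y' ω ∂μ = (K - K') / b := by
  obtain ⟨C, hC⟩ := exists_mgf_of_stable (μ := μ) hb hb1
  have hnhds : Ioo (-b) b ∈ 𝓝 (0 : ℝ) := Ioo_mem_nhds (by linarith) hb
  have hint : 0 ∈ interior (integrableExpSet Y μ) := mem_interior_iff_mem_nhds.2
    (mem_of_superset hnhds fun c hc => (hC hY hL c hc.1 hc.2).1)
  have hint' : 0 ∈ interior (integrableExpSet Y' μ) := mem_interior_iff_mem_nhds.2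
    (mem_of_superset hnhds fun c hc => (hC hY' hL' c hc.1 hc.2).1)
  refine ⟨integrable_of_mem_interior_integrableExpSet hint,
    integrable_of_mem_interior_integrableExpSet hint', ?_⟩
  have heq : mgf Y μ =ᶠ[𝓝 0] fun c => mgf Y' μ c * Real.exp (c * ((K - K') / b)) := by
    filter_upwards [hnhds] with c hc
    rw [(hC hY hL c hc.1 hc.2).2, (hC hY' hL' c hc.1 hc.2).2, mul_assoc, ← Real.exp_add]
    congr 2
    field_simp
    ring
  have h1 := heq.deriv_eq
  have h2 : HasDerivAt (fun c : ℝ => Real.exp (c * ((K - K') / b))) ((K - K') / b) 0 := by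
    have := ((hasDerivAt_id (0 : ℝ)).mul_const ((K - K') / b)).exp
    simpa using this
  have h3 := ((differentiableAt_mgf hint').hasDerivAt.mul h2).deriv
  rw [deriv_mgf_zero hint] at h1
  rw [deriv_mgf_zero hint'] at h3
  simp only [Pi.mul_def] at h3
  rw [h1, h3]
  simp

end Stable

/-! ### The logarithm of the partition function -/

section Partition

variable {k : ℕ} {x g : List ℕ → ℝ} {F : (Fin k → ℝ) → ℝ}

lemma treeSum_eq_mul (x g : List ℕ → ℝ) (F : (Fin k → ℝ) → ℝ) (a s : ℝ) :
    treeSum x g F a s = ENNReal.ofReal (Real.exp s) * treeSum x g F a 0 := by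
  rw [treeSum, treeSum, ← ENNReal.tsum_mul_left]
  refine tsum_congr fun α => ?_
  rw [← ENNReal.ofReal_mul (Real.exp_pos _).le, ← Real.exp_add, zero_add]

lemma treeSum_ne_zero (x g : List ℕ → ℝ) (F : (Fin k → ℝ) → ℝ) (a s : ℝ) :
    treeSum x g F a s ≠ 0 := by
  intro h
  have := ENNReal.tsum_eq_zero.1 h fun _ => 0
  exact (ENNReal.ofReal_pos.2 (Real.exp_pos _)).ne' this

lemma parisiRecursion_zero (m : ℕ → ℝ) (k : ℕ) :
    parisiRecursion m k (fun _ => 0) = 0 := by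
  induction k with
  | zero => rfl
  | succ k ih => simpa [parisiRecursion, parisiStep] using ih

lemma linearGrowth_zero (k : ℕ) : LinearGrowth (k := k) 0 0 fun _ => 0 where
  measurable := measurable_const
  nonneg := le_rfl
  bound x := by simp

variable {Ω Ω' : Type*} [MeasurableSpace Ω] [MeasurableSpace Ω'] {P : Measure Ω} {Q : Measure Ω'}
  [IsProbabilityMeasure P] [IsProbabilityMeasure Q] {m : ℕ → ℝ} {x : List ℕ → Ω → ℝ}
  {g : List ℕ → Ω' → ℝ}

/-- The effect of a field on the logarithm of the partition function of a cascade. -/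
theorem integral_log_treeSum (hm1 : 0 < m 1) (hmk : m (k + 1) = 1)
    (hm : ∀ i, 1 ≤ i → i ≤ k → m i < m (i + 1)) (hx : IsCascade P k m x)
    (hg : IsGaussianTree Q k g) {A B : ℝ} (hF : LinearGrowth A B F) :
    (∀ᵐ p ∂(P.prod Q), treeSum (fun γ => x γ p.1) (fun γ => g γ p.2) F 1 0 ≠ ∞) ∧
    (∀ᵐ p ∂(P.prod Q), treeSum (k := k) (fun γ => x γ p.1) (fun γ => g γ p.2) (fun _ => 0) 1 0
      ≠ ∞) ∧
    Integrable (fun p : Ω × Ω' => Real.log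
      (treeSum (fun γ => x γ p.1) (fun γ => g γ p.2) F 1 0).toReal) (P.prod Q) ∧
    Integrable (fun p : Ω × Ω' => Real.log (treeSum (k := k)
      (fun γ => x γ p.1) (fun γ => g γ p.2) (fun _ => 0) 1 0).toReal) (P.prod Q) ∧
    ∫ p, Real.log (treeSum (fun γ => x γ p.1) (fun γ => g γ p.2) F 1 0).toReal ∂(P.prod Q)
      - ∫ p, Real.log (treeSum (k := k) (fun γ => x γ p.1) (fun γ => g γ p.2)
        (fun _ => 0) 1 0).toReal ∂(P.prod Q) = parisiRecursion m k F := by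
  have hmle : ∀ n, n ≤ k → m 1 ≤ m (n + 1) := by
    intro n
    induction n with
    | zero => intro _; exact le_rfl
    | succ n ih => intro hn; exact (ih (by omega)).trans (hm (n + 1) (by omega) hn).le
  have hm1' : m 1 ≤ 1 := hmk ▸ hmle k le_rfl
  obtain ⟨D, hD⟩ := exists_lintegral_expNeg_treeSum hm1 hm hx hg
  rw [hmk] at hD
  have key : ∀ {A B : ℝ} {F : (Fin k → ℝ) → ℝ}, LinearGrowth A B F →
      Measurable (fun p : Ω × Ω' => treeSum (fun γ => x γ p.1) (fun γ => g γ p.2) F 1 0) ∧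
      (∀ᵐ p ∂(P.prod Q), treeSum (fun γ => x γ p.1) (fun γ => g γ p.2) F 1 0 ≠ ∞) ∧
      ∀ s, ∫⁻ p, expNeg (ENNReal.ofReal (Real.exp (s + Real.log (treeSum (fun γ => x γ p.1)
        (fun γ => g γ p.2) F 1 0).toReal))) ∂(P.prod Q)
        = expNeg (ENNReal.ofReal (Real.exp ((D + m 1 * parisiRecursion m k F) + m 1 * s))) := by
    intro A B F hF
    have hmeas := measurable_treeSum hx hg hF.measurable 1 0
    have hL : ∀ s, ∫⁻ p, expNeg (ENNReal.ofReal (Real.exp s) * treeSum (fun γ => x γ p.1)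
        (fun γ => g γ p.2) F 1 0) ∂(P.prod Q)
        = expNeg (ENNReal.ofReal (Real.exp ((D + m 1 * parisiRecursion m k F) + m 1 * s))) := by
      intro s
      simp_rw [← treeSum_eq_mul]
      have hms := measurable_expNeg.comp (measurable_treeSum hx hg hF.measurable 1 s)
      rw [lintegral_prod (fun p : Ω × Ω' => expNeg (treeSum (fun γ => x γ p.1) (fun γ => g γ p.2)
        F 1 s)) hms.aemeasurable, hD hF le_rfl s]
      congr 3
      ring
    have hae := ae_ne_top_of_stable hmeas hm1 hL
    refine ⟨hmeas, hae, fun s => ?_⟩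
    rw [← hL]
    refine lintegral_congr_ae ?_
    filter_upwards [hae] with p hp
    rw [Real.exp_add, Real.exp_log (ENNReal.toReal_pos (treeSum_ne_zero _ _ _ _ _) hp),
      ENNReal.ofReal_mul (Real.exp_pos _).le, ENNReal.ofReal_toReal hp]
  obtain ⟨h1, h2, h3⟩ := key hF
  -- For the zero function the recursion vanishes and `D` is the same, so the two scale parameters
  -- differ by `m 1 * parisiRecursion m k F`.
  obtain ⟨h1', h2', h3'⟩ := key (linearGrowth_zero k)
  obtain ⟨i1, i2, i3⟩ := integral_log_of_stable hm1 hm1' h1.ennreal_toReal.log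
    h1'.ennreal_toReal.log h3 h3'
  refine ⟨h2, h2', i1, i2, ?_⟩
  rw [i3, parisiRecursion_zero]
  field_simp
  ring

end Partition

/-! ### Averages with respect to the cascade weights -/

section Weights

variable {k : ℕ}

/-- The vertices of the tree other than the root. -/
abbrev TreeVertex (k : ℕ) : Type := {γ : List ℕ // γ ≠ [] ∧ γ.length ≤ k}

/-- The vertex at level `i + 1` on the path to the leaf `α`. -/
def pathVertex (α : Fin k → ℕ) (i : Fin k) : TreeVertex k :=
  ⟨ancestor α (i + 1), ancestor_succ_ne_nil α i, by
    rw [length_ancestor α (Nat.succ_le_of_lt i.2)]; exact i.2⟩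

/-- `∑_α ν_α e^{F (y along the path to α)}`. -/
def weightedSum (F : (Fin k → ℝ) → ℝ) (ν : (Fin k → ℕ) → ℝ) (y : TreeVertex k → ℝ) : ℝ≥0∞ :=
  ∑' α, ENNReal.ofReal (ν α * Real.exp (F fun i => y (pathVertex α i)))

lemma measurable_weightedSum {F : (Fin k → ℝ) → ℝ} (hF : Measurable F) :
    Measurable fun p : ((Fin k → ℕ) → ℝ) × (TreeVertex k → ℝ) => weightedSum F p.1 p.2 := by
  unfold weightedSum
  refine Measurable.tsum fun α => ?_
  have h : Measurable fun p : ((Fin k → ℕ) → ℝ) × (TreeVertex k → ℝ) =>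
      F fun i => p.2 (pathVertex α i) := hF.comp (by fun_prop)
  fun_prop

lemma summable_iff_tsum_ofReal_ne_top {ι : Type*} {f : ι → ℝ} (hf : ∀ i, 0 ≤ f i) :
    Summable f ↔ ∑' i, ENNReal.ofReal (f i) ≠ ∞ := by
  constructor
  · exact fun h => h.tsum_ofReal_ne_top
  · intro h
    have := ENNReal.summable_toReal h
    simpa [ENNReal.toReal_ofReal (hf _)] using this

lemma tsum_eq_toReal_tsum_ofReal {ι : Type*} {f : ι → ℝ} (hf : ∀ i, 0 ≤ f i) :
    ∑' i, f i = (∑' i, ENNReal.ofReal (f i)).toReal := by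
  rw [ENNReal.tsum_toReal_eq fun _ => ENNReal.ofReal_ne_top]
  simp [ENNReal.toReal_ofReal (hf _)]

lemma rpcWeight_nonneg (x : List ℕ → ℝ) (α : Fin k → ℕ) : 0 ≤ rpcWeight x α :=
  div_nonneg (Real.exp_pos _).le (tsum_nonneg fun _ => (Real.exp_pos _).le)

lemma treeSum_zero (x g : List ℕ → ℝ) :
    treeSum (k := k) x g (fun _ => 0) 1 0 = ∑' α : Fin k → ℕ, ENNReal.ofReal (Real.exp (pathSum x α)) := by
  simp [treeSum]

/-- No summability is required: if the normalizing sum diverges, its real `tsum` is `0`, all weights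
are `0`, and both sides vanish. -/
lemma weightedSum_rpcWeight (x g : List ℕ → ℝ) (F : (Fin k → ℝ) → ℝ) :
    weightedSum F (fun α => rpcWeight x α) (fun γ => g γ.1)
      = ENNReal.ofReal ((treeSum (k := k) x g (fun _ => 0) 1 0).toReal)⁻¹ * treeSum x g F 1 0 := by
  change _ = _ * ∑' α : Fin k → ℕ,
    ENNReal.ofReal (Real.exp (0 + 1 * (pathSum x α + F (pathValues g α))))
  rw [weightedSum, ← ENNReal.tsum_mul_left]
  refine tsum_congr fun α => ?_
  rw [← ENNReal.ofReal_mul (inv_nonneg.2 ENNReal.toReal_nonneg), rpcWeight, treeSum_zero,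
    ← tsum_eq_toReal_tsum_ofReal fun _ => (Real.exp_pos _).le, zero_add, one_mul, Real.exp_add,
    div_eq_inv_mul, mul_assoc]
  rfl

lemma IsCascade.measurable_rpcWeight {Ω : Type*} [MeasurableSpace Ω] {P : Measure Ω} {m : ℕ → ℝ}
    {x : List ℕ → Ω → ℝ} (h : IsCascade P k m x) (α : Fin k → ℕ) :
    Measurable fun ω => rpcWeight (fun γ => x γ ω) α := by
  have hm := h.measurable_pathSum
  unfold rpcWeight
  simp_rw [tsum_eq_toReal_tsum_ofReal fun (δ : Fin k → ℕ) =>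
    (Real.exp_pos (pathSum (fun γ => x γ _) δ)).le]
  exact (hm α).exp.div (Measurable.tsum fun δ => (hm δ).exp.ennreal_ofReal).ennreal_toReal

variable {Ω : Type*} [MeasurableSpace Ω] {P : Measure Ω} {m : ℕ → ℝ} {x g : List ℕ → Ω → ℝ}

lemma IsRPCWithGaussians.isGaussianTree (h : IsRPCWithGaussians P k m x g) :
    IsGaussianTree P k g :=
  ⟨h.gaussian_measurable, h.gaussian_law, h.gaussian_indep⟩

/-- Only the weights, not the points `x`, are assumed independent of the Gaussians. The computation
is therefore made on `P.prod P`, where `x` and `g` use different coordinates and the joint law of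
weights and Gaussians is unchanged. -/
lemma IsRPCWithGaussians.identDistrib [IsProbabilityMeasure P] (h : IsRPCWithGaussians P k m x g) :
    IdentDistrib
      (fun ω => ((fun α : Fin k → ℕ => rpcWeight (fun γ => x γ ω) α),
        fun γ : TreeVertex k => g γ.1 ω))
      (fun p : Ω × Ω => ((fun α : Fin k → ℕ => rpcWeight (fun γ => x γ p.1) α),
        fun γ : TreeVertex k => g γ.1 p.2)) P (P.prod P) := by
  have hν : Measurable fun ω (α : Fin k → ℕ) => rpcWeight (fun γ => x γ ω) α :=
    measurable_pi_lambda _ fun α => h.cascade.measurable_rpcWeight α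
  have hg : Measurable fun ω (γ : TreeVertex k) => g γ.1 ω :=
    measurable_pi_lambda _ fun γ => h.gaussian_measurable γ.1 γ.2.1 γ.2.2
  refine ⟨(hν.prodMk hg).aemeasurable,
    ((hν.comp measurable_fst).prodMk (hg.comp measurable_snd)).aemeasurable, ?_⟩
  rw [(indepFun_iff_map_prod_eq_prod_map_map hν.aemeasurable hg.aemeasurable).1 h.indep,
    Measure.map_prod_map P P hν hg]
  rfl

/-- Exponential averages over a Ruelle probability cascade are given by the backward recursion. -/
theorem IsRPCWithGaussians.integral_log_tsum [IsProbabilityMeasure P]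
    (h : IsRPCWithGaussians P k m x g) (hm1 : 0 < m 1) (hmk : m (k + 1) = 1)
    (hm : ∀ i, 1 ≤ i → i ≤ k → m i < m (i + 1)) {A B : ℝ} {F : (Fin k → ℝ) → ℝ}
    (hF : LinearGrowth A B F) :
    (∀ᵐ ω ∂P, Summable fun α : Fin k → ℕ => Real.exp (pathSum (fun γ => x γ ω) α)) ∧
    (∀ᵐ ω ∂P, Summable fun α : Fin k → ℕ =>
      rpcWeight (fun γ => x γ ω) α * Real.exp (F (pathValues (fun γ => g γ ω) α))) ∧
    Integrable (fun ω => Real.log (∑' α : Fin k → ℕ,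
      rpcWeight (fun γ => x γ ω) α * Real.exp (F (pathValues (fun γ => g γ ω) α)))) P ∧
    ∫ ω, Real.log (∑' α : Fin k → ℕ,
      rpcWeight (fun γ => x γ ω) α * Real.exp (F (pathValues (fun γ => g γ ω) α))) ∂P
      = parisiRecursion m k F := by
  obtain ⟨hF1, h01, hF2, h02, heq⟩ :=
    integral_log_treeSum hm1 hmk hm h.cascade h.isGaussianTree hF
  have hid := h.identDistrib
  have hmeas := measurable_weightedSum hF.measurable
  have hnn : ∀ (x g : List ℕ → ℝ) (α : Fin k → ℕ),
      0 ≤ rpcWeight x α * Real.exp (F (pathValues g α)) := fun x g α =>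
    mul_nonneg (rpcWeight_nonneg x α) (Real.exp_pos _).le
  have hsum : ∀ ω, ∑' α : Fin k → ℕ,
      rpcWeight (fun γ => x γ ω) α * Real.exp (F (pathValues (fun γ => g γ ω) α))
      = (weightedSum F (fun α => rpcWeight (fun γ => x γ ω) α) fun γ => g γ.1 ω).toReal :=
    fun ω => tsum_eq_toReal_tsum_ofReal (hnn _ _)
  have hlog : ∀ᵐ p ∂(P.prod P),
      Real.log (weightedSum F (fun α => rpcWeight (fun γ => x γ p.1) α) fun γ => g γ.1 p.2).toReal
      = Real.log (treeSum (fun γ => x γ p.1) (fun γ => g γ p.2) F 1 0).toReal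
        - Real.log (treeSum (k := k) (fun γ => x γ p.1) (fun γ => g γ p.2) (fun _ => 0) 1 0).toReal := by
    filter_upwards [hF1, h01] with p hp1 hp2
    have hF0 := ENNReal.toReal_pos (treeSum_ne_zero _ _ _ _ _) hp1
    have h00 := ENNReal.toReal_pos (treeSum_ne_zero _ _ _ _ _) hp2
    rw [weightedSum_rpcWeight (fun γ => x γ p.1) (fun γ => g γ p.2), ENNReal.toReal_mul,
      ENNReal.toReal_ofReal (inv_nonneg.2 h00.le), Real.log_mul (inv_ne_zero h00.ne') hF0.ne',
      Real.log_inv]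
    ring
  have hidlog := hid.comp (hmeas.ennreal_toReal.log)
  have hint : Integrable (fun p : Ω × Ω => Real.log (weightedSum F
      (fun α => rpcWeight (fun γ => x γ p.1) α) fun γ => g γ.1 p.2).toReal) (P.prod P) :=
    (hF2.sub h02).congr (hlog.mono fun p hp => hp.symm)
  refine ⟨?_, ?_, ?_, ?_⟩
  -- The sum `Z_0` does not involve the Gaussian coordinate, so a single `ω'` suffices.
  · filter_upwards [Measure.ae_ae_of_ae_prod h01] with ω hω
    obtain ⟨ω', hω'⟩ := hω.exists
    rw [summable_iff_tsum_ofReal_ne_top fun _ => (Real.exp_pos _).le]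
    rwa [treeSum_zero] at hω'
  · have hs : MeasurableSet {p : ((Fin k → ℕ) → ℝ) × (TreeVertex k → ℝ) |
        weightedSum F p.1 p.2 ≠ ∞} := (hmeas (measurableSet_singleton ∞)).compl
    have hae := hid.symm.ae_mem_snd hs (by
      filter_upwards [hF1] with p hp
      have := weightedSum_rpcWeight (fun γ => x γ p.1) (fun γ => g γ p.2) F
      exact this ▸ ENNReal.mul_ne_top ENNReal.ofReal_ne_top hp)
    filter_upwards [hae] with ω hω
    rw [summable_iff_tsum_ofReal_ne_top (hnn _ _)]
    exact hω
  · simp_rw [hsum]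
    exact hidlog.integrable_iff.2 hint
  · simp_rw [hsum]
    have h1 := hidlog.integral_eq
    simp only [Function.comp_def] at h1
    rw [h1, integral_congr_ae hlog, integral_sub hF2 h02, heq]

end Weights

/-! ### The two fields -/

section Fields

variable {k : ℕ}

lemma sum_Icc_one_eq_sum_fin (f : ℕ → ℝ) (k : ℕ) :
    ∑ l ∈ Finset.Icc 1 k, f l = ∑ i : Fin k, f (i + 1) := by
  induction k with
  | zero => simp
  | succ k ih => rw [Finset.sum_Icc_succ_top (by omega), ih, Fin.sum_univ_castSucc]; simp

lemma abs_sum_mul_le (c x : Fin k → ℝ) : |∑ i, c i * x i| ≤ (∑ i, |c i|) * ∑ i, |x i| := by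
  calc |∑ i, c i * x i| ≤ ∑ i, |c i * x i| := Finset.abs_sum_le_sum_abs _ _
    _ ≤ ∑ i, |c i| * ∑ j, |x j| := by
        refine Finset.sum_le_sum fun i _ => ?_
        rw [abs_mul]
        gcongr
        exact Finset.single_le_sum (f := fun j => |x j|) (fun j _ => abs_nonneg _)
          (Finset.mem_univ i)
    _ = _ := by rw [Finset.sum_mul]

lemma abs_log_two_cosh_le (u : ℝ) : |Real.log (2 * Real.cosh u)| ≤ Real.log 2 + |u| := by
  have h1 : 1 ≤ 2 * Real.cosh u := by linarith [Real.one_le_cosh u]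
  rw [abs_of_nonneg (Real.log_nonneg h1), ← Real.log_exp |u|, ← Real.log_mul two_ne_zero
    (Real.exp_pos _).ne']
  refine Real.log_le_log (by linarith) ?_
  rw [← Real.cosh_abs, Real.cosh_eq]
  have : Real.exp (-|u|) ≤ Real.exp |u| := Real.exp_le_exp.2 (by linarith [abs_nonneg u])
  linarith

lemma linearGrowth_log_two_cosh (β : ℝ) (c : Fin k → ℝ) :
    LinearGrowth (Real.log 2) (|β| * ∑ i, |c i|)
      fun x => Real.log (2 * Real.cosh (β * ∑ i, c i * x i)) where
  measurable := by fun_prop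
  nonneg := by positivity
  bound x := by
    refine (abs_log_two_cosh_le _).trans ?_
    rw [abs_mul, mul_assoc]
    gcongr
    exact abs_sum_mul_le c x

lemma linearGrowth_sum (C : ℝ) (c : Fin k → ℝ) :
    LinearGrowth |C| (∑ i, |c i|) fun x => C + ∑ i, c i * x i where
  measurable := by fun_prop
  nonneg := by positivity
  bound x := (abs_add_le _ _).trans (add_le_add le_rfl (abs_sum_mul_le c x))

lemma parisiStep_affine {a : ℝ} (ha : a ≠ 0) (C c : ℝ) :
    parisiStep a (fun y => C + c * y) = C + a * c ^ 2 / 2 := by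
  rw [parisiStep, if_neg ha]
  have h1 : ∀ y, Real.exp (a * (C + c * y)) = Real.exp (a * C) * Real.exp ((a * c) * y) := by
    intro y
    rw [← Real.exp_add]
    congr 1
    ring
  have h2 := congrFun (mgf_id_gaussianReal (μ := 0) (v := 1)) (a * c)
  simp only [mgf, id] at h2
  simp_rw [h1]
  rw [integral_const_mul, h2, ← Real.exp_add, Real.log_exp]
  field_simp
  simp only [zero_mul, NNReal.coe_one, zero_add]
  ring

/-- The Gaussian moment generating function keeps affine functions affine at every step and adds `m
(i + 1) * c i ^ 2 / 2` to the constant. -/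
lemma parisiRecursion_affine {m : ℕ → ℝ} (c : ℕ → ℝ) :
    ∀ (k : ℕ) (C : ℝ), (∀ i, i < k → m (i + 1) ≠ 0) →
      parisiRecursion m k (fun x => C + ∑ i : Fin k, c i * x i)
        = C + ∑ i ∈ Finset.range k, m (i + 1) * c i ^ 2 / 2 := by
  intro k
  induction k with
  | zero => intro C _; simp [parisiRecursion]
  | succ k ih =>
    intro C hm
    rw [parisiRecursion]
    have h1 : ∀ x : Fin k → ℝ, parisiStep (m (k + 1)) (fun y => C + ∑ i : Fin (k + 1),
        c i * (Fin.snoc (α := fun _ => ℝ) x y : Fin (k + 1) → ℝ) i)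
        = (C + m (k + 1) * c k ^ 2 / 2) + ∑ i : Fin k, c i * x i := by
      intro x
      simp_rw [Fin.sum_univ_castSucc, Fin.snoc_castSucc, Fin.snoc_last, ← add_assoc]
      simp only [Fin.val_castSucc, Fin.val_last]
      rw [parisiStep_affine (hm k (by omega))]
      ring
    simp_rw [h1]
    rw [ih _ fun i hi => hm i (by omega), Finset.sum_range_succ]
    ring

/-- Summation by parts, converting increments of `q ^ 2` into the increments of `m` that appear in
the functional. -/
lemma sum_range_mul_sub (m q : ℕ → ℝ) (h0 : q 0 = 0) (k : ℕ) :
    ∑ i ∈ Finset.range k, m (i + 1) * (q (i + 1) ^ 2 - q i ^ 2)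
      = m (k + 1) * q k ^ 2 - ∑ i ∈ Finset.range (k + 1), (m (i + 1) - m i) * q i ^ 2 := by
  induction k with
  | zero => simp [h0]
  | succ k ih =>
    rw [Finset.sum_range_succ, ih, Finset.sum_range_succ _ (k + 1)]
    ring

end Fields

/-! ### The identity for nondegenerate parameters and continuity in `m` -/

/-- The representation of the free energy functional by a cascade with parameters `m`. -/
theorem IsRPCWithGaussians.psiRSB_eq {k : ℕ} {β : ℝ} {q m : ℕ → ℝ}
    (hq0 : q 0 = 0) (hqk : q k = 1) (hq : ∀ i, i < k → q i ≤ q (i + 1))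
    (hm0 : m 0 = 0) (hmk : m (k + 1) = 1) (hm : ∀ i, i ≤ k → m i < m (i + 1))
    {Ω : Type*} [MeasurableSpace Ω] {P : Measure Ω} [IsProbabilityMeasure P]
    {x g : List ℕ → Ω → ℝ} (h : IsRPCWithGaussians P k m x g) :
    (∀ᵐ ω ∂P, Summable fun α : Fin k → ℕ => Real.exp (pathSum (fun γ => x γ ω) α)) ∧
    (∀ᵐ ω ∂P, Summable fun α : Fin k → ℕ =>
      rpcWeight (fun γ => x γ ω) α * Real.cosh (hField β q (fun γ => g γ ω) α)) ∧
    (∀ᵐ ω ∂P, Summable fun α : Fin k → ℕ =>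
      rpcWeight (fun γ => x γ ω) α * Real.exp (sField β q (fun γ => g γ ω) α)) ∧
    Integrable (fun ω => Real.log (2 * ∑' α : Fin k → ℕ,
      rpcWeight (fun γ => x γ ω) α * Real.cosh (hField β q (fun γ => g γ ω) α))) P ∧
    Integrable (fun ω => Real.log (∑' α : Fin k → ℕ,
      rpcWeight (fun γ => x γ ω) α * Real.exp (sField β q (fun γ => g γ ω) α))) P ∧
    PsiRSB β k q m =
      (∫ ω, Real.log (2 * ∑' α : Fin k → ℕ,
        rpcWeight (fun γ => x γ ω) α * Real.cosh (hField β q (fun γ => g γ ω) α)) ∂P) -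
      ∫ ω, Real.log (∑' α : Fin k → ℕ,
        rpcWeight (fun γ => x γ ω) α * Real.exp (sField β q (fun γ => g γ ω) α)) ∂P := by
  have hpos : ∀ i, i ≤ k → 0 < m (i + 1) := by
    intro i
    induction i with
    | zero => intro _; have := hm 0 (by omega); rwa [hm0] at this
    | succ i ih => intro hi; exact (ih (by omega)).trans (hm (i + 1) hi)
  have hqn : ∀ i, i ≤ k → 0 ≤ q i := by
    intro i
    induction i with
    | zero => intro _; exact hq0.ge
    | succ i ih => intro hi; exact (ih (by omega)).trans (hq i (by omega))
  set c : ℕ → ℝ := fun i => √(q (i + 1) - q i) with hc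
  set d : ℕ → ℝ := fun i => β * √(q (i + 1) ^ 2 / 2 - q i ^ 2 / 2) with hd
  have hh : ∀ (g : List ℕ → ℝ) (α : Fin k → ℕ),
      hField β q g α = β * ∑ i : Fin k, c i * pathValues g α i := by
    intro g α
    rw [hField, sum_Icc_one_eq_sum_fin]
    rfl
  have hs : ∀ (g : List ℕ → ℝ) (α : Fin k → ℕ),
      sField β q g α = 0 + ∑ i : Fin k, d i * pathValues g α i := by
    intro g α
    rw [sField, sum_Icc_one_eq_sum_fin, Finset.mul_sum, zero_add]
    refine Finset.sum_congr rfl fun i _ => ?_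
    simp only [hd, pathValues, add_tsub_cancel_right]
    ring
  have hcosh : ∀ u : ℝ, Real.exp (Real.log (2 * Real.cosh u)) = 2 * Real.cosh u := fun u =>
    Real.exp_log (by linarith [Real.cosh_pos u])
  obtain ⟨a1, a2, a3, a4⟩ := h.integral_log_tsum (hpos 0 (by omega)) hmk (fun i _ hi => hm i hi)
    (linearGrowth_log_two_cosh β fun i : Fin k => c i)
  obtain ⟨-, b2, b3, b4⟩ := h.integral_log_tsum (hpos 0 (by omega)) hmk (fun i _ hi => hm i hi)
    (linearGrowth_sum 0 fun i : Fin k => d i)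
  simp_rw [hcosh, ← hh] at a2 a3 a4
  simp_rw [← hs] at b2 b3 b4
  have h2 : ∀ (ω : Ω) (α : Fin k → ℕ), rpcWeight (fun γ => x γ ω) α *
      (2 * Real.cosh (hField β q (fun γ => g γ ω) α))
      = 2 * (rpcWeight (fun γ => x γ ω) α * Real.cosh (hField β q (fun γ => g γ ω) α)) :=
    fun ω α => by ring
  simp_rw [h2] at a2 a3 a4
  simp_rw [tsum_mul_left] at a3 a4
  refine ⟨a1, ?_, b2, a3, b3, ?_⟩
  · filter_upwards [a2] with ω hω
    exact (summable_mul_left_iff two_ne_zero).1 hω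
  · rw [a4, b4, parisiRecursion_affine d k 0 fun i hi => (hpos i hi.le).ne', PsiRSB]
    have h3 : ∑ i ∈ Finset.range k, m (i + 1) * d i ^ 2 / 2
        = β ^ 2 / 4 * ∑ i ∈ Finset.range k, m (i + 1) * (q (i + 1) ^ 2 - q i ^ 2) := by
      rw [Finset.mul_sum]
      refine Finset.sum_congr rfl fun i hi => ?_
      rw [Finset.mem_range] at hi
      have h4 : q i ^ 2 ≤ q (i + 1) ^ 2 := pow_le_pow_left₀ (hqn i hi.le) (hq i hi) 2
      simp only [hd]
      rw [mul_pow, Real.sq_sqrt (by linarith)]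
      ring
    -- As `m (k + 1) = q k = 1`, the second expectation is `β ^ 2 / 4` times one minus the sum in
    -- `PsiRSB`, the negative of its polynomial part.
    rw [h3, sum_range_mul_sub m q hq0, hmk, hqk]
    simp only [hc]
    ring

/-- The free energy functional is continuous in the parameters `m`. -/
lemma tendsto_psiRSB {k : ℕ} (β : ℝ) (q : ℕ → ℝ) {m : ℕ → ℝ} {ms : ℕ → ℕ → ℝ}
    (hms : ∀ i, 1 ≤ i → i ≤ k → ∀ n, 0 < ms n i ∧ ms n i ≤ 1)
    (hlim : ∀ i, i ≤ k + 1 → Tendsto (fun n => ms n i) atTop (𝓝 (m i))) :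
    Tendsto (fun n => PsiRSB β k q (ms n)) atTop (𝓝 (PsiRSB β k q m)) := by
  unfold PsiRSB
  refine (tendsto_const_nhds.add (tendsto_const_nhds.mul (tendsto_finsetSum _ fun i hi => ?_))).add
    (tendsto_parisiRecursion hms (fun i _ hi => hlim i (by omega))
      (fun n => linearGrowth_log_two_cosh β fun i : Fin k => √(q (i + 1) - q i))
      fun x => tendsto_const_nhds)
  rw [Finset.mem_range] at hi
  exact ((hlim (i + 1) (by omega)).sub (hlim i (by omega))).mul_const _

end

/-! ### The theorem, with the limit of degenerate parameters -/

theorem mainTheorem5 (k : ℕ) (hk : 1 ≤ k) (β : ℝ) (q : ℕ → ℝ)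
    (hq0 : q 0 = 0) (hqk : q k = 1) (hq : ∀ i, i < k → q i ≤ q (i + 1)) :
    -- nondegenerate parameters `0 = m 0 < m 1 < ⋯ < m k < m (k + 1) = 1`
    (∀ m : ℕ → ℝ, m 0 = 0 → m (k + 1) = 1 → (∀ i, i ≤ k → m i < m (i + 1)) →
      ∀ (Ω : Type*) [MeasurableSpace Ω] (P : Measure Ω) [IsProbabilityMeasure P]
        (x g : List ℕ → Ω → ℝ), IsRPCWithGaussians P k m x g →
        (∀ᵐ ω ∂P, Summable fun α : Fin k → ℕ => Real.exp (pathSum (fun γ => x γ ω) α)) ∧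
        (∀ᵐ ω ∂P, Summable fun α : Fin k → ℕ =>
          rpcWeight (fun γ => x γ ω) α * Real.cosh (hField β q (fun γ => g γ ω) α)) ∧
        (∀ᵐ ω ∂P, Summable fun α : Fin k → ℕ =>
          rpcWeight (fun γ => x γ ω) α * Real.exp (sField β q (fun γ => g γ ω) α)) ∧
        Integrable (fun ω => Real.log (2 * ∑' α : Fin k → ℕ,
          rpcWeight (fun γ => x γ ω) α * Real.cosh (hField β q (fun γ => g γ ω) α))) P ∧
        Integrable (fun ω => Real.log (∑' α : Fin k → ℕ,
          rpcWeight (fun γ => x γ ω) α * Real.exp (sField β q (fun γ => g γ ω) α))) P ∧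
        PsiRSB β k q m =
          (∫ ω, Real.log (2 * ∑' α : Fin k → ℕ,
            rpcWeight (fun γ => x γ ω) α * Real.cosh (hField β q (fun γ => g γ ω) α)) ∂P) -
          ∫ ω, Real.log (∑' α : Fin k → ℕ,
            rpcWeight (fun γ => x γ ω) α * Real.exp (sField β q (fun γ => g γ ω) α)) ∂P) ∧
    -- all parameters `0 = m 0 ≤ m 1 ≤ ⋯ ≤ m k ≤ m (k + 1) = 1`, as a limit of nondegenerate ones
    (∀ m : ℕ → ℝ, m 0 = 0 → m (k + 1) = 1 → (∀ i, i ≤ k → m i ≤ m (i + 1)) →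
      ∀ ε : ℝ, 0 < ε → ∃ δ : ℝ, 0 < δ ∧
      ∀ m' : ℕ → ℝ, m' 0 = 0 → m' (k + 1) = 1 → (∀ i, i ≤ k → m' i < m' (i + 1)) →
        (∀ i, 1 ≤ i → i ≤ k → |m' i - m i| < δ) →
      ∀ (Ω : Type*) [MeasurableSpace Ω] (P : Measure Ω) [IsProbabilityMeasure P]
        (x g : List ℕ → Ω → ℝ), IsRPCWithGaussians P k m' x g →
        |PsiRSB β k q m -
          ((∫ ω, Real.log (2 * ∑' α : Fin k → ℕ,
            rpcWeight (fun γ => x γ ω) α * Real.cosh (hField β q (fun γ => g γ ω) α)) ∂P) -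
          ∫ ω, Real.log (∑' α : Fin k → ℕ,
            rpcWeight (fun γ => x γ ω) α * Real.exp (sField β q (fun γ => g γ ω) α)) ∂P)| < ε) := by
  refine ⟨fun m hm0 hmk hm Ω _ P _ x g h => h.psiRSB_eq hq0 hqk hq hm0 hmk hm,
    fun m hm0 hmk _ ε hε => ?_⟩
  have hcont : ∃ δ : ℝ, 0 < δ ∧ ∀ m' : ℕ → ℝ, m' 0 = 0 → m' (k + 1) = 1 →
      (∀ i, i ≤ k → m' i < m' (i + 1)) → (∀ i, 1 ≤ i → i ≤ k → |m' i - m i| < δ) →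
      |PsiRSB β k q m - PsiRSB β k q m'| < ε := by
    -- Continuity is known along sequences, so the choices `δ = 1 / (n + 1)` give a sequence of
    -- parameters contradicting it.
    by_contra! hcon
    choose ms hms0 hmsk hms hclose hfar using fun n : ℕ => hcon (1 / ((n : ℝ) + 1)) (by positivity)
    have hmono : ∀ n i j, i ≤ j → j ≤ k + 1 → ms n i ≤ ms n j := by
      intro n i j hij
      induction j, hij using Nat.le_induction with
      | base => exact fun _ => le_rfl
      | succ j hij ih => exact fun hj => (ih (by omega)).trans (hms n j (by omega)).le
    have hlim : ∀ i, i ≤ k + 1 → Filter.Tendsto (fun n => ms n i) Filter.atTop (nhds (m i)) := by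
      intro i hi
      rcases Nat.eq_zero_or_pos i with rfl | hi0
      · simp_rw [hms0, hm0]
        exact tendsto_const_nhds
      rcases hi.eq_or_lt with rfl | hik
      · simp_rw [hmsk, hmk]
        exact tendsto_const_nhds
      rw [tendsto_iff_norm_sub_tendsto_zero]
      exact squeeze_zero (fun n => norm_nonneg _) (fun n => (hclose n i hi0 (by omega)).le)
        tendsto_one_div_add_atTop_nhds_zero_nat
    have hT := tendsto_psiRSB (k := k) β q (ms := ms) (m := m) (fun i h1 h2 n => ⟨by
      have h3 := hms n 0 (by omega)
      rw [hms0] at h3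
      exact h3.trans_le (hmono n 1 i h1 (by omega)), by
      rw [← hmsk n]
      exact hmono n i (k + 1) (by omega) le_rfl⟩) hlim
    have hT' := (tendsto_const_nhds (x := PsiRSB β k q m)).sub hT |>.abs
    rw [sub_self, abs_zero] at hT'
    exact absurd (ge_of_tendsto' hT' hfar) (not_le.2 hε)
  obtain ⟨δ, hδ, hcont⟩ := hcont
  refine ⟨δ, hδ, fun m' hm0' hmk' hm' hclose Ω _ P _ x g h => ?_⟩
  rw [← (h.psiRSB_eq (β := β) hq0 hqk hq hm0' hmk' hm').2.2.2.2.2]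
  exact hcont m' hm0' hmk' hm' hclose
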